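/- Let $\Omega\subseteq\mathbb R^n$ be non-empty, open and convex, let $T_\Omega=\mathbb R^n+i\Omega\subseteq\mathbb C^n$, and write $\Omega'\Subset\Omega$ if $\overline{\Omega'}$ is a compact subset of $\Omega$. Let $HAP(T_\Omega,\mathbb C^m)$ be the space of holomorphic mappings $F=(f_1,\dots,f_m):T_\Omega\to\mathbb C^m$ which are almost periodic: for all $\varepsilon>0$ and $\Omega'\Subset\Omega$ there is $t\in(0,\infty)^n$ such that every box $\{x\in\mathbb R^n : |x_k-\xi_k|<t_k,\ 1\le k\le n\}$, $\xi\in\mathbb R^n$, contains a $\tau$ with $\sup_{z\in T_{\Omega'}}\max_\ell|f_\ell(z+\tau)-f_\ell(z)|<\varepsilon$. It carries the topology $\tau(T_\Omega)$ of uniform convergence on every $T_{\Omega'}$, $\Omega'\Subset\Omega$. With $\langle z,\lambda\rangle=\sum_k z_k\lambda_k$, put, for $\lambda\in\mathbb R^n$, $$a(\lambda,f_\ell)=\lim_{s\to+\infty}\frac1{(2s)^n}\int_{|x_k|<s,\ 1\le k\le n}e^{-i\langle x+iy,\lambda\rangle}f_\ell(x+iy)\,dx ,$$ which does not depend on $y\in\Omega$,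 and $\mathrm{Sp}\,f_\ell=\{\lambda : a(\lambda,f_\ell)\ne0\}$. Let $\Xi_F$ be the additive subgroup of $\mathbb R^n$ generated by $\bigcup_\ell\mathrm{Sp}\,f_\ell$ and $\mathrm{lin}_{\mathbb Q}\,\Xi_F$ its $\mathbb Q$-linear span. For a finite or infinite sequence $(\omega_r)_{r\ge1}$ which is a basis of $\mathrm{lin}_{\mathbb Q}\,\Xi_F$ over $\mathbb Q$ and $j\in\mathbb N$, the Bochner–Fejér approximation $Q_j(F)=(Q_j(f_1),\dots,Q_j(f_m))$ is $$Q_j(f_\ell)(z)=\sum_{\nu}\ \prod_{r}\Bigl(1-\frac{|\nu_r|}{(j!)^2}\Bigr)\,a\Bigl(\sum_{r}\nu_r\frac{\omega_r}{j!},f_\ell\Bigr)\exp\Bigl(i\sum_{r}\nu_r\Bigl\langle z,\frac{\omega_r}{j!}\Bigr\rangle\Bigr),$$ where $r$ runs over the indices $1\le r\le j$ of the basis (over all indices if the basis has fewer than $j$ elements) and $\nu=(\nu_r)$ over the tuples of integers with $|\nu_r|\le(j!)^2$. Let $\mathrm{Exp}(T_\Omega,\mathbb C^m)$ be the set of mappings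 whose components are finite (possibly zero) $\mathbb C$-linear combinations of exponentials $e^{i\langle z,\lambda\rangle}$, $\lambda\in\mathbb R^n$. For a character $\chi\in\mathrm{Ch}\,\mathbb R^n$, i.e. a (not necessarily continuous) homomorphism $\chi:(\mathbb R^n,+)\to\mathbb S^1$, and $G=(g_1,\dots,g_m)\in\mathrm{Exp}(T_\Omega,\mathbb C^m)$, let $G_\chi$ be the mapping with components $(g_\ell)_\chi(z)=\sum_{\lambda\in\mathrm{Sp}\,g_\ell}a(\lambda,g_\ell)\,\chi(\lambda)\,e^{i\langle z,\lambda\rangle}$. **Theorem 3.1.** Let $F\in HAP(T_\Omega,\mathbb C^m)$, let $\chi\in\mathrm{Ch}\,\mathbb R^n$, let $(\omega_r)$ be a basis of $\mathrm{lin}_{\mathbb Q}\,\Xi_F$ as above, and let $Q_j(F)$ be the corresponding Bochner–Fejér approximations. Then $Q_j(F)\in\mathrm{Exp}(T_\Omega,\mathbb C^m)$ for every $j$, the perturbed mappings $(Q_j(F))_\chi$ lie in $HAP(T_\Omega,\mathbb C^m)$ and form a Cauchy sequence for $\tau(T_\Omega)$, and this sequence converges in $\tau(T_\Omega)$ to a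 unique limit $F_\chi\in HAP(T_\Omega,\mathbb C^m)$. -/

import Mathlib

open Filter Topology MeasureTheory
open scoped Nat

namespace HolAP

noncomputable section

/-- The complex bilinear pairing `⟨z, l⟩ = ∑ z_k l_k` of `z ∈ ℂⁿ` with a real frequency `l ∈ ℝⁿ`. -/
def pairing {n : ℕ} (z : Fin n → ℂ) (l : Fin n → ℝ) : ℂ := ∑ k, z k * (l k : ℂ)

/-- The point `x + i y` of `ℂⁿ`. -/
def cpoint {n : ℕ} (x y : Fin n → ℝ) : Fin n → ℂ := fun k => (x k : ℂ) + Complex.I * (y k : ℂ)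

/-- The horizontal tube `T_Ω = ℝⁿ + iΩ`. -/
def tube {n : ℕ} (Ω : Set (Fin n → ℝ)) : Set (Fin n → ℂ) := {z | (fun k => (z k).im) ∈ Ω}

/-- `Ω' ⋐ Ω`: the closure of `Ω'` is compact and contained in `Ω`. -/
def RelCompactIn {n : ℕ} (Ω' Ω : Set (Fin n → ℝ)) : Prop :=
  IsCompact (closure Ω') ∧ closure Ω' ⊆ Ω

/-- Almost periodicity in `T_Ω`, in the sense of Bohr: for all `ε > 0` and `Ω' ⋐ Ω` there are side
lengths `t` such that every open box `{x | |x_k - ξ_k| < t_k}` contains an `ε`-almost period. -/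
def IsAlmostPeriodic {n m : ℕ} (Ω : Set (Fin n → ℝ)) (F : (Fin n → ℂ) → (Fin m → ℂ)) : Prop :=
  ∀ ε : ℝ, 0 < ε → ∀ Ω' : Set (Fin n → ℝ), RelCompactIn Ω' Ω →
    ∃ t : Fin n → ℝ, (∀ k, 0 < t k) ∧ ∀ ξ : Fin n → ℝ,
      ∃ τ : Fin n → ℝ, (∀ k, |τ k - ξ k| < t k) ∧
        ∀ z ∈ tube Ω', ∀ ℓ, ‖F (fun k => z k + (τ k : ℂ)) ℓ - F z ℓ‖ < ε

/-- Membership in `HAP(T_Ω, ℂᵐ)`. Mappings on `T_Ω` are represented by functions on `ℂⁿ`, of which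
only the values on `T_Ω` matter. -/
def IsHAP {n m : ℕ} (Ω : Set (Fin n → ℝ)) (F : (Fin n → ℂ) → (Fin m → ℂ)) : Prop :=
  DifferentiableOn ℂ F (tube Ω) ∧ IsAlmostPeriodic Ω F

/-- Convergence of a sequence in the topology `τ(T_Ω)`: uniformly on every subtube `T_Ω'`, `Ω' ⋐ Ω`.
The norm on `Fin m → ℂ` is the maximum of the absolute values of the components. -/
def TendstoTau {n m : ℕ} (Ω : Set (Fin n → ℝ)) (G : ℕ → (Fin n → ℂ) → (Fin m → ℂ))
    (H : (Fin n → ℂ) → (Fin m → ℂ)) : Prop :=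
  ∀ Ω' : Set (Fin n → ℝ), RelCompactIn Ω' Ω → TendstoUniformlyOn G H atTop (tube Ω')

/-- Cauchy sequences for the topology `τ(T_Ω)`. -/
def CauchyTau {n m : ℕ} (Ω : Set (Fin n → ℝ)) (G : ℕ → (Fin n → ℂ) → (Fin m → ℂ)) : Prop :=
  ∀ Ω' : Set (Fin n → ℝ), RelCompactIn Ω' Ω → UniformCauchySeqOn G atTop (tube Ω')

/-- The mean `(2s)⁻ⁿ ∫_{|x_k| < s} e^{-i⟨x+iy, l⟩} f(x+iy) dx`. -/
def bohrMean {n : ℕ} (f : (Fin n → ℂ) → ℂ) (l y : Fin n → ℝ) (s : ℝ) : ℂ :=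
  (1 / ((2 * s) ^ n : ℝ) : ℂ) *
    ∫ x in {x : Fin n → ℝ | ∀ k, |x k| < s},
      Complex.exp (-Complex.I * pairing (cpoint x y) l) * f (cpoint x y)

open Classical in
/-- The Bohr transform `a(l, f)`: the limit of `bohrMean f l y s` as `s → +∞`, common to
all `y ∈ Ω`. (The value is `0` if there is no such common limit.) -/
def bohrTransform {n : ℕ} (Ω : Set (Fin n → ℝ)) (f : (Fin n → ℂ) → ℂ) (l : Fin n → ℝ) : ℂ :=
  if h : ∃ c : ℂ, ∀ y ∈ Ω, Tendsto (bohrMean f l y) atTop (𝓝 c) then h.choose else 0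

/-- The spectrum `Sp f`. -/
def spec {n : ℕ} (Ω : Set (Fin n → ℝ)) (f : (Fin n → ℂ) → ℂ) : Set (Fin n → ℝ) :=
  {l | bohrTransform Ω f l ≠ 0}

/-- The `ℤ`-module `Ξ_F`, generated by the spectra of the components of `F`. -/
def specModule {n m : ℕ} (Ω : Set (Fin n → ℝ)) (F : (Fin n → ℂ) → (Fin m → ℂ)) :
    AddSubgroup (Fin n → ℝ) :=
  AddSubgroup.closure (⋃ ℓ, spec Ω (fun z => F z ℓ))

/-- The `ℚ`-linear span `lin_ℚ Ξ_F` in `ℝⁿ`. -/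
def linQ {n m : ℕ} (Ω : Set (Fin n → ℝ)) (F : (Fin n → ℂ) → (Fin m → ℂ)) :
    Submodule ℚ (Fin n → ℝ) :=
  Submodule.span ℚ (specModule Ω F : Set (Fin n → ℝ))

/-- Mappings on `T_Ω` whose components are exponential sums, i.e. finite `ℂ`-linear combinations of
exponentials `e^{i⟨z, l⟩}` with `l ∈ ℝⁿ` (the zero sum is allowed). -/
def IsExp {n m : ℕ} (Ω : Set (Fin n → ℝ)) (F : (Fin n → ℂ) → (Fin m → ℂ)) : Prop :=
  ∀ ℓ, ∃ (S : Finset (Fin n → ℝ)) (c : (Fin n → ℝ) → ℂ),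
    ∀ z ∈ tube Ω, F z ℓ = ∑ l ∈ S, c l * Complex.exp (Complex.I * pairing z l)

/-- The index set `{r ∈ ℕ | r < d}` of a (finite or infinite) sequence of length `d ∈ ℕ ∪ {∞}`. -/
abbrev Idx (d : ℕ∞) : Type := {r : ℕ // (r : ℕ∞) < d}

/-- Indices of the first `j` terms of a sequence of length `d` (all its terms if `d ≤ j`). -/
abbrev IdxTo (d : ℕ∞) (j : ℕ) : Type := {r : Fin j // ((r : ℕ) : ℕ∞) < d}

/-- The frequency `∑_r ν_r (ω_r / j!)`, the sum being over the first `j` terms of `ω`. -/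
def freq {n : ℕ} {d : ℕ∞} (ω : Idx d → (Fin n → ℝ)) (j : ℕ) (ν : IdxTo d j → ℤ) : Fin n → ℝ :=
  ∑ r : IdxTo d j, (ν r : ℝ) • ((j ! : ℝ)⁻¹ • ω ⟨(r.1 : ℕ), r.2⟩)

/-- The Bochner-Fejer approximation `Q_j(F)` corresponding to the sequence `ω`. The sum is
over all tuples `ν` of integers with `|ν_r| ≤ (j!)²`. -/
def bochnerFejer {n m : ℕ} (Ω : Set (Fin n → ℝ)) (F : (Fin n → ℂ) → (Fin m → ℂ)) {d : ℕ∞}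
    (ω : Idx d → (Fin n → ℝ)) (j : ℕ) : (Fin n → ℂ) → (Fin m → ℂ) :=
  fun z ℓ =>
    ∑ ν ∈ Fintype.piFinset
        (fun _ : IdxTo d j => Finset.Icc (-((j ! : ℤ) ^ 2)) ((j ! : ℤ) ^ 2)),
      ((∏ r : IdxTo d j, (1 - |(ν r : ℝ)| / (j ! : ℝ) ^ 2) : ℝ) : ℂ) *
        bohrTransform Ω (fun w => F w ℓ) (freq ω j ν) *
        Complex.exp (Complex.I * pairing z (freq ω j ν))

/-- The perturbation `F_χ` of `F ∈ Exp(T_Ω, ℂᵐ)` by a (not necessarily continuous) character `χ`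
of the additive group `ℝⁿ`: `(f_ℓ)_χ(z) = ∑_{l ∈ Sp f_ℓ} a(l, f_ℓ) χ(l) e^{i⟨z, l⟩}`. -/
def perturb {n m : ℕ} (Ω : Set (Fin n → ℝ)) (χ : AddChar (Fin n → ℝ) Circle)
    (F : (Fin n → ℂ) → (Fin m → ℂ)) : (Fin n → ℂ) → (Fin m → ℂ) :=
  fun z ℓ => ∑ᶠ l ∈ spec Ω (fun w => F w ℓ),
    bohrTransform Ω (fun w => F w ℓ) l * (χ l : ℂ) * Complex.exp (Complex.I * pairing z l)

end

end HolAP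

/-!
The perturbed Bochner-Fejér sums are treated slice by slice: for fixed `y` in the base, the
component `f_ℓ` is an almost periodic function `x ↦ f_ℓ(x + iy)` on `ℝⁿ`, and its perturbed sum is
the mean value of this function against a product of Fejér kernels, translated by the values of
`χ` at the basic frequencies. Such a product is nonnegative whatever the character is, and its mean
is `1` because the basic frequencies are linearly independent over `ℚ`. Hence the perturbed sums are
contractions for the supremum norm (`norm_fejerSum_le`), and no approximation of `χ` by continuous
characters is needed. On the exponential `e_l` the `j`-th sum acts as multiplication by
`χ(l)` and a factor that tends to `1` for `l` in the rational span of the basis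
(`tendsto_fejerMultiplier`). The two facts together give the Cauchy property as soon as `f_ℓ` is a
uniform limit of exponential sums with frequencies in the group generated by its spectrum
(`fejerSum_cauchy`).

This approximation theorem (`BohrAP.exists_approx`) is proved, with values in `C(K)` for a compact
`K` in the base, by passing to a compact group. The completion of `ℝⁿ` for the seminorm
`t ↦ sup_x ‖f(x + t) - f(x)‖` is a compact group `G` to which `f` extends
(`BohrAP.exists_compact_group`). By the uniqueness theorem for Fourier series on `G`
(`eq_zero_of_fourier_eq_zero`), a point of `G` at which all characters in the spectrum are `1`
leaves the extension invariant, hence is `0`. So the characters in the spectrum separate points,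
and the Stone-Weierstrass theorem on `G × K` applies. The uniqueness theorem in turn comes from the
spectral theorem for compact self-adjoint operators: convolution by a nonzero Hermitian function
has a nonzero eigenvalue, its eigenspace is finite-dimensional and translation invariant, and common
eigenvectors of the translations are characters.

That the Bohr transform is a limit common to all `y` follows from Cauchy's theorem on long
rectangles (`IsHAP.coeff_indep`). The limit of the Cauchy sequence is holomorphic by the Weierstrass
theorem and inherits almost periodicity from uniform convergence (`IsHAP.of_tendstoTau`).
-/

open Filter Topology MeasureTheory
open scoped Nat

namespace HolAP

/-! ### Convolution operators on a compact abelian group -/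

section CompactGroup

open scoped InnerProductSpace ComplexConjugate

variable {G : Type*} [NormedAddCommGroup G]

/-- The function `t ↦ conj f(x - t)` on `G`, so that `⟪convKernel f x, h⟫ = (f * h)(x)`. -/
noncomputable def convKernel (f : C(G, ℂ)) : C(G, C(G, ℂ)) :=
  ContinuousMap.curry ⟨fun p : G × G => conj (f (p.1 - p.2)), by fun_prop⟩

@[simp] lemma convKernel_apply (f : C(G, ℂ)) (x t : G) : convKernel f x t = conj (f (x - t)) := rfl

variable [CompactSpace G] [MeasurableSpace G] [BorelSpace G] (μ : Measure G)
  [IsProbabilityMeasure μ]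

/-- Convolution with the continuous function `f`, as an operator from `L²(G)` to `C(G)`. -/
noncomputable def convLp (f : C(G, ℂ)) : Lp ℂ 2 μ →L[ℂ] C(G, ℂ) :=
  LinearMap.mkContinuous
    { toFun := fun h => ⟨fun x => ⟪ContinuousMap.toLp 2 μ ℂ (convKernel f x), h⟫_ℂ, by fun_prop⟩
      map_add' := fun h k => by ext x; simp [inner_add_right]
      map_smul' := fun c h => by ext x; simp [inner_smul_right] }
    ‖(⟨fun x => ContinuousMap.toLp 2 μ ℂ (convKernel f x), by fun_prop⟩ : C(G, Lp ℂ 2 μ))‖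
    (fun h => by
      refine (ContinuousMap.norm_le _ (by positivity)).2 fun x => ?_
      refine (norm_inner_le_norm (𝕜 := ℂ) (E := Lp ℂ 2 μ) _ _).trans ?_
      gcongr
      exact ContinuousMap.norm_coe_le_norm
        (⟨fun x => ContinuousMap.toLp 2 μ ℂ (convKernel f x), by fun_prop⟩ : C(G, Lp ℂ 2 μ)) x)

lemma convLp_apply (f : C(G, ℂ)) (h : Lp ℂ 2 μ) (x : G) :
    convLp μ f h x = ⟪ContinuousMap.toLp 2 μ ℂ (convKernel f x), h⟫_ℂ := rfl

lemma convLp_toLp (f h : C(G, ℂ)) (x : G) :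
    convLp μ f (ContinuousMap.toLp 2 μ ℂ h) x = ∫ t, f (x - t) * h t ∂μ := by
  rw [convLp_apply, ContinuousMap.inner_toLp]
  simp [mul_comm]

/-- The image of the unit ball is bounded and equicontinuous, since `convKernel f` is continuous as
a map to `L²(G)`; so the Arzelà-Ascoli theorem applies. -/
lemma isCompactOperator_convLp (f : C(G, ℂ)) : IsCompactOperator (convLp μ f) := by
  let e := (ContinuousMap.linearIsometryBoundedOfCompact G ℂ ℂ)
  let B := e.toContinuousLinearEquiv.toContinuousLinearMap.comp (convLp μ f)
  have hB : IsCompactOperator B := by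
    refine (isCompactOperator_iff_isCompact_closure_image_ball
      (B : Lp ℂ 2 μ →ₗ[ℂ] BoundedContinuousFunction G ℂ) one_pos).2 ?_
    refine BoundedContinuousFunction.arzela_ascoli (Metric.closedBall 0 ‖B‖)
      (isCompact_closedBall _ _) _ ?_ ?_
    · rintro _ x ⟨h, hh, rfl⟩
      rw [mem_closedBall_zero_iff]
      refine (BoundedContinuousFunction.norm_coe_le_norm _ x).trans ?_
      refine (B.le_opNorm h).trans ?_
      exact mul_le_of_le_one_right (norm_nonneg _) ((mem_ball_zero_iff.1 hh).le)
    · intro x₀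
      rw [Metric.equicontinuousAt_iff_right]
      intro ε hε
      have hc : Continuous fun x => ContinuousMap.toLp 2 μ ℂ (convKernel f x) := by fun_prop
      have := Metric.continuous_iff'.1 hc x₀ ε hε
      filter_upwards [this] with x hx
      rintro ⟨_, h, hh, rfl⟩
      change dist (convLp μ f h x₀) (convLp μ f h x) < ε
      rw [dist_comm, dist_eq_norm, convLp_apply, convLp_apply, ← inner_sub_left]
      refine (norm_inner_le_norm _ _).trans_lt ?_
      rw [dist_eq_norm] at hx
      refine lt_of_le_of_lt ?_ hx
      exact mul_le_of_le_one_right (norm_nonneg _) ((mem_ball_zero_iff.1 hh).le)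
  have : (convLp μ f : Lp ℂ 2 μ → C(G, ℂ)) = e.symm.toContinuousLinearEquiv ∘ B := by
    ext h x; simp [B]
  rw [this]
  exact hB.clm_comp e.symm.toContinuousLinearEquiv.toContinuousLinearMap

/-- Convolution with `f` as an operator on `L²(G)`. -/
noncomputable def convOp (f : C(G, ℂ)) : Lp ℂ 2 μ →L[ℂ] Lp ℂ 2 μ :=
  (ContinuousMap.toLp 2 μ ℂ).comp (convLp μ f)

lemma isCompactOperator_convOp (f : C(G, ℂ)) : IsCompactOperator (convOp μ f) :=
  (isCompactOperator_convLp μ f).clm_comp (ContinuousMap.toLp 2 μ ℂ)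

lemma isSymmetric_convOp {f : C(G, ℂ)} (hf : ∀ x, f (-x) = conj (f x)) :
    (convOp μ f).IsSymmetric := by
  have hd : DenseRange (ContinuousMap.toLp 2 μ ℂ : C(G, ℂ) →L[ℂ] Lp ℂ 2 μ) :=
    ContinuousMap.toLp_denseRange ℂ μ ℂ (by simp)
  intro h k
  simp only [ContinuousLinearMap.coe_coe]
  refine hd.induction_on₂ (p := fun h k => ⟪convOp μ f h, k⟫_ℂ = ⟪h, convOp μ f k⟫_ℂ)
    (isClosed_eq (by fun_prop) (by fun_prop)) ?_ h k
  intro a b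
  simp only [convOp, ContinuousLinearMap.comp_apply]
  rw [ContinuousMap.inner_toLp, ContinuousMap.inner_toLp]
  simp only [convLp_toLp, ← integral_conj, ← integral_mul_const, ← integral_const_mul, map_mul]
  rw [integral_integral_swap_of_hasCompactSupport]
  · congr 1; ext t; congr 1; ext x
    rw [← hf, neg_sub]; ring
  · fun_prop
  · exact HasCompactSupport.of_compactSpace _

lemma convOp_ne_zero [μ.IsOpenPosMeasure] {f : C(G, ℂ)} (hf : f ≠ 0) : convOp μ f ≠ 0 := by
  contrapose! hf
  have h1 : ∀ h, convLp μ f h = 0 := fun h => by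
    apply ContinuousMap.toLp_injective μ (p := 2) (𝕜 := ℂ)
    rw [map_zero]
    exact DFunLike.congr_fun hf h
  have h2 : convKernel f 0 = (0 : C(G, ℂ)) := by
    apply ContinuousMap.toLp_injective μ (p := 2) (𝕜 := ℂ)
    refine Eq.trans ?_ (map_zero _).symm
    rw [← inner_self_eq_zero (𝕜 := ℂ), ← convLp_apply, h1]
    rfl
  ext x
  have := DFunLike.congr_fun h2 (-x)
  simpa using this

end CompactGroup

/-- A commuting family of endomorphisms of a nonzero finite-dimensional complex vector space has a
common eigenvector. -/
lemma exists_common_eigenvector {V ι : Type*} [AddCommGroup V] [Module ℂ V]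
    (U : ι → Module.End ℂ V) (hU : ∀ i j, Commute (U i) (U j)) (E : Submodule ℂ V)
    [FiniteDimensional ℂ E] (hE : E ≠ ⊥) (hinv : ∀ i, ∀ v ∈ E, U i v ∈ E) :
    ∃ v ∈ E, v ≠ 0 ∧ ∀ i, ∃ c : ℂ, U i v = c • v := by
  -- an invariant nonzero subspace of least dimension consists of common eigenvectors
  let P : ℕ → Prop := fun k => ∃ W : Submodule ℂ V, W ≤ E ∧ W ≠ ⊥ ∧ (∀ i, ∀ v ∈ W, U i v ∈ W) ∧
    Module.finrank ℂ W = k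
  have hP : ∃ k, P k := ⟨_, E, le_rfl, hE, hinv, rfl⟩
  classical
  obtain ⟨W, hWE, hW0, hWi, hWk⟩ := Nat.find_spec hP
  have : FiniteDimensional ℂ W := Submodule.finiteDimensional_of_le hWE
  have : Nontrivial W := (Submodule.nontrivial_iff_ne_bot).2 hW0
  obtain ⟨v, hvW, hv0⟩ := (Submodule.ne_bot_iff _).1 hW0
  refine ⟨v, hWE hvW, hv0, fun i => ?_⟩
  obtain ⟨c, hc⟩ := Module.End.exists_eigenvalue ((U i).restrict (hWi i))
  obtain ⟨w, hw⟩ := hc.exists_hasEigenvector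
  let W' : Submodule ℂ V := W ⊓ Module.End.eigenspace (U i) c
  have hwW' : (w : V) ∈ W' := by
    refine ⟨w.2, Module.End.mem_eigenspace_iff.2 ?_⟩
    simpa using congrArg Subtype.val hw.apply_eq_smul
  have hW'0 : W' ≠ ⊥ := (Submodule.ne_bot_iff _).2 ⟨w, hwW', fun h => hw.2 (Subtype.ext h)⟩
  have hW'i : ∀ j, ∀ u ∈ W', U j u ∈ W' := fun j u hu => by
    refine ⟨hWi j u hu.1, Module.End.mem_eigenspace_iff.2 ?_⟩
    have h1 := DFunLike.congr_fun (hU i j) u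
    simp only [Module.End.mul_apply] at h1
    rw [h1, Module.End.mem_eigenspace_iff.1 hu.2, map_smul]
  have hle : W' ≤ W := inf_le_left
  have hmin : Nat.find hP ≤ Module.finrank ℂ W' :=
    Nat.find_min' hP ⟨W', hle.trans hWE, hW'0, hW'i, rfl⟩
  have heq : W' = W := Submodule.eq_of_le_of_finrank_le hle (by omega)
  exact ⟨c, Module.End.mem_eigenspace_iff.1 ((heq ▸ hvW : v ∈ W').2)⟩

/-! ### Characters and uniqueness of Fourier series -/

section Uniqueness

open scoped InnerProductSpace ComplexConjugate

variable {G : Type*} [NormedAddCommGroup G] [CompactSpace G] [MeasurableSpace G] [BorelSpace G]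
  (μ : Measure G) [IsProbabilityMeasure μ] [μ.IsAddHaarMeasure]

/-- Translation by `g` on `C(G)`. -/
noncomputable def translate {G : Type*} [NormedAddCommGroup G] (g : G) : Module.End ℂ C(G, ℂ) where
  toFun h := ⟨fun x => h (x + g), by fun_prop⟩
  map_add' _ _ := rfl
  map_smul' _ _ := rfl

lemma translate_apply {G : Type*} [NormedAddCommGroup G] (g : G) (h : C(G, ℂ)) (x : G) :
    translate g h x = h (x + g) := rfl

/-- A continuous function with `h(x + g) = c(g) h(x)` is a multiple of a character. -/
lemma exists_character_of_translate {G : Type*} [NormedAddCommGroup G] [CompactSpace G]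
    {h : C(G, ℂ)} (h0 : h ≠ 0) (hc : ∀ g, ∃ c : ℂ, translate g h = c • h) :
    ∃ χ : AddChar G Circle, Continuous χ ∧ ∀ x, h x = h 0 * χ x := by
  choose c hc using hc
  have hmul : ∀ g x, h (x + g) = c g * h x := fun g x => by
    rw [← translate_apply, hc]; simp
  have hh0 : h 0 ≠ 0 := by
    intro h00
    apply h0
    ext x
    have := hmul x 0
    simpa [h00] using this
  have hcx : ∀ x, h x = c x * h 0 := fun x => by simpa using hmul x 0
  have hcc : Continuous c := by
    have : c = fun x => h x / h 0 := by
      ext x; rw [hcx x]; field_simp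
    rw [this]; fun_prop
  have hc0 : c 0 = 1 := by
    have := hcx 0
    exact mul_right_cancel₀ hh0 (by rw [← this, one_mul])
  have hcadd : ∀ x y, c (x + y) = c x * c y := fun x y => by
    have h1 := hmul y x
    rw [hcx, hcx x] at h1
    exact mul_right_cancel₀ hh0 (by rw [h1]; ring)
  have hnle : ∀ x, ‖c x‖ ≤ 1 := by
    -- otherwise the powers `c (k • x) = c x ^ k` are unbounded
    intro x
    by_contra! hx
    obtain ⟨B, hB⟩ : ∃ B, ∀ y, ‖c y‖ ≤ B := by
      obtain ⟨B, hB⟩ := isCompact_univ.exists_bound_of_continuousOn hcc.continuousOn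
      exact ⟨B, fun y => hB y trivial⟩
    have hp : ∀ k : ℕ, c (k • x) = c x ^ k := by
      intro k
      induction k with
      | zero => simpa using hc0
      | succ k ih => rw [succ_nsmul, hcadd, ih, pow_succ]
    obtain ⟨k, hk⟩ := pow_unbounded_of_one_lt B hx
    have := hB (k • x)
    rw [hp, norm_pow] at this
    exact absurd hk (not_lt.2 this)
  have hnorm : ∀ x, ‖c x‖ = 1 := fun x => by
    refine le_antisymm (hnle x) ?_
    have h1 : c x * c (-x) = 1 := by rw [← hcadd, add_neg_cancel, hc0]
    have h2 : ‖c x‖ * ‖c (-x)‖ = 1 := by rw [← norm_mul, h1, norm_one]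
    nlinarith [hnle (-x), norm_nonneg (c x), norm_nonneg (c (-x))]
  refine ⟨{ toFun := fun x => ⟨c x, mem_sphere_zero_iff_norm.2 (hnorm x)⟩
            map_zero_eq_one' := Circle.ext hc0
            map_add_eq_mul' := fun x y => Circle.ext (hcadd x y) }, ?_, fun x => ?_⟩
  · exact Continuous.subtype_mk hcc _
  · rw [hcx x, mul_comm]; rfl

/-- A nonzero Hermitian continuous function on a compact abelian group correlates with some
character: translations act on the finite-dimensional eigenspaces of the convolution operator, and
their common eigenvectors are characters. -/
lemma exists_character_integral_ne_zero {f : C(G, ℂ)} (hf : ∀ x, f (-x) = conj (f x))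
    (h0 : f ≠ 0) :
    ∃ χ : AddChar G Circle, Continuous χ ∧ ∫ t, conj (f t) * χ t ∂μ ≠ 0 := by
  have hcomp := isCompactOperator_convOp μ f
  have hne := convOp_ne_zero μ h0
  have hev := (ContinuousLinearMap.eq_zero_of_forall_hasEigenvalue_eq_zero hcomp
    (isSymmetric_convOp μ hf)).not.2 hne
  push Not at hev
  obtain ⟨κ, hκ, hκ0⟩ := hev
  have hinj := ContinuousMap.toLp_injective μ (p := 2) (𝕜 := ℂ) (α := G) (E := ℂ)
  let J : C(G, ℂ) →ₗ[ℂ] Lp ℂ 2 μ := (ContinuousMap.toLp 2 μ ℂ : C(G, ℂ) →L[ℂ] Lp ℂ 2 μ)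
  let E := (Module.End.eigenspace (convOp μ f : Module.End ℂ (Lp ℂ 2 μ)) κ).comap J
  have hmem : ∀ h, h ∈ E ↔ ∀ x, ∫ t, f (x - t) * h t ∂μ = κ * h x := by
    intro h
    rw [Submodule.mem_comap, Module.End.mem_eigenspace_iff]
    change (ContinuousMap.toLp 2 μ ℂ) (convLp μ f (ContinuousMap.toLp 2 μ ℂ h)) =
      κ • ContinuousMap.toLp 2 μ ℂ h ↔ _
    rw [← map_smul, hinj.eq_iff, ContinuousMap.ext_iff]
    simp [convLp_toLp]
  have hfd : FiniteDimensional ℂ E := by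
    have := ContinuousLinearMap.finite_dimensional_eigenspace hcomp κ hκ0
    refine Module.Finite.of_injective (J.restrict (p := E)
      (q := Module.End.eigenspace (convOp μ f : Module.End ℂ (Lp ℂ 2 μ)) κ) fun v hv => hv) ?_
    intro a b hab
    exact Subtype.ext (hinj (congrArg Subtype.val hab))
  have hE : E ≠ ⊥ := by
    obtain ⟨v, hv⟩ := hκ.exists_hasEigenvector
    have hv1 : (ContinuousMap.toLp 2 μ ℂ) (convLp μ f v) = κ • v := hv.apply_eq_smul
    have hv2 : J (κ⁻¹ • convLp μ f v) = v := by
      rw [map_smul]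
      change κ⁻¹ • (ContinuousMap.toLp 2 μ ℂ) (convLp μ f v) = v
      rw [hv1, smul_smul, inv_mul_cancel₀ hκ0, one_smul]
    refine (Submodule.ne_bot_iff _).2 ⟨κ⁻¹ • convLp μ f v, ?_, fun h => hv.2 ?_⟩
    · rw [Submodule.mem_comap, hv2]; exact hv.1
    · rw [← hv2, h, map_zero]
  obtain ⟨h, hhE, hh0, hh⟩ := exists_common_eigenvector (fun g : G => translate g)
    (fun g g' => by
      ext h x
      simp only [Module.End.mul_apply, translate_apply]
      rw [add_right_comm]) E hE (fun g v hv => by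
      rw [hmem] at hv ⊢
      intro x
      rw [translate_apply, ← hv (x + g),
        ← integral_add_right_eq_self (fun t => f (x + g - t) * v t) g]
      simp only [translate_apply, add_sub_add_right_eq_sub])
  obtain ⟨χ, hχ, hhχ⟩ := exists_character_of_translate hh0 hh
  refine ⟨χ, hχ, ?_⟩
  have h1 := (hmem h).1 hhE 0
  have h00 : h 0 ≠ 0 := fun h00 => hh0 (by ext x; rw [hhχ, h00]; simp)
  have h2 : h 0 * ∫ t, conj (f t) * χ t ∂μ = h 0 * κ := by
    rw [← integral_const_mul, mul_comm _ κ, ← h1]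
    congr 1; ext t
    rw [zero_sub, hf, hhχ t]; ring
  rw [mul_left_cancel₀ h00 h2]
  exact hκ0

/-- **Uniqueness theorem** for Fourier series on a compact abelian group. -/
theorem eq_zero_of_fourier_eq_zero (f : C(G, ℂ))
    (hf : ∀ χ : AddChar G Circle, Continuous χ → ∫ t, f t * conj (χ t : ℂ) ∂μ = 0) : f = 0 := by
  let r : C(G, ℂ) := ⟨fun x => conj (f (-x)), by fun_prop⟩
  have hr : ∀ χ : AddChar G Circle, Continuous χ → ∫ t, r t * conj (χ t : ℂ) ∂μ = 0 := by
    intro χ hχ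
    rw [← integral_neg_eq_self]
    have := congrArg conj (hf χ hχ)
    rw [← integral_conj, map_zero] at this
    rw [← this]
    congr 1; ext t
    simp [r, AddChar.map_neg_eq_inv, ← Circle.coe_inv_eq_conj]
  have hint : ∀ g : C(G, ℂ), Integrable g μ := fun g =>
    g.continuous.integrable_of_hasCompactSupport (HasCompactSupport.of_compactSpace _)
  -- the Hermitian functions `a f + conj a r` have vanishing Fourier coefficients
  have key : ∀ a : ℂ, a • f + conj a • r = 0 := by
    intro a
    by_contra hne
    obtain ⟨χ, hχ, hint0⟩ := exists_character_integral_ne_zero μ (f := a • f + conj a • r)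
      (by intro x; simp [r]; ring) hne
    apply hint0
    have hχc : Continuous fun t => conj (χ t : ℂ) := by fun_prop
    have e1 : ∫ t, (a • f + conj a • r) t * conj (χ t : ℂ) ∂μ = 0 := by
      have : ∀ t, (a • f + conj a • r) t * conj (χ t : ℂ) =
          a * (f t * conj (χ t : ℂ)) + conj a * (r t * conj (χ t : ℂ)) := by
        intro t; simp; ring
      simp only [this]
      rw [integral_add, integral_const_mul, integral_const_mul, hf χ hχ, hr χ hχ]
      · simp
      · exact (hint ⟨fun t => a * (f t * conj (χ t : ℂ)), by fun_prop⟩)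
      · exact (hint ⟨fun t => conj a * (r t * conj (χ t : ℂ)), by fun_prop⟩)
    have := congrArg conj e1
    rw [← integral_conj, map_zero] at this
    simpa using this
  have k1 := key 1
  have k2 := key Complex.I
  ext x
  have h1 := DFunLike.congr_fun k1 x
  have h2 := DFunLike.congr_fun k2 x
  simp only [map_one, one_smul, ContinuousMap.add_apply, ContinuousMap.zero_apply,
    ContinuousMap.smul_apply, Complex.conj_I, smul_eq_mul] at h1 h2 ⊢
  have h3 : Complex.I * (f x - r x) = 0 := by linear_combination h2
  have h4 : f x - r x = 0 := (mul_eq_zero.1 h3).resolve_left Complex.I_ne_zero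
  linear_combination (h1 + h4) / 2

end Uniqueness

/-! ### Almost periodic functions extend to compact groups -/

section Hull

/-- A Bohr almost periodic function `V → E`: for every `ε > 0` the `ε`-almost periods are
relatively dense in `V`. -/
def BohrAP {V E : Type*} [NormedAddCommGroup V] [NormedAddCommGroup E] (f : V → E) : Prop :=
  ∀ ε > 0, ∃ R : ℝ, ∀ ξ : V, ∃ τ : V, ‖τ - ξ‖ ≤ R ∧ ∀ x, ‖f (x + τ) - f x‖ ≤ ε

variable {V E : Type*} [NormedAddCommGroup V] [NormedAddCommGroup E] {f : V → E}

lemma BohrAP.bounded [ProperSpace V] (hf : BohrAP f) (hc : Continuous f) :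
    ∃ B, ∀ x, ‖f x‖ ≤ B := by
  obtain ⟨R, hR⟩ := hf 1 one_pos
  obtain ⟨B, hB⟩ := (isCompact_closedBall (0 : V) R).exists_bound_of_continuousOn hc.continuousOn
  refine ⟨B + 1, fun x => ?_⟩
  obtain ⟨τ, hτ, h⟩ := hR (-x)
  have h1 := hB (x + τ) (by simpa [add_comm] using hτ)
  have h2 := norm_sub_norm_le (f x) (f (x + τ))
  rw [norm_sub_rev] at h2
  linarith [h x]

lemma BohrAP.uniform [ProperSpace V] (hf : BohrAP f) (hc : Continuous f) {ε : ℝ} (hε : 0 < ε) :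
    ∃ δ > 0, ∀ t : V, ‖t‖ < δ → ∀ x, ‖f (x + t) - f x‖ ≤ ε := by
  obtain ⟨R, hR⟩ := hf (ε / 3) (by positivity)
  have hu := (isCompact_closedBall (0 : V) (R + 1)).uniformContinuousOn_of_continuous
    hc.continuousOn
  obtain ⟨δ, hδ, h⟩ := Metric.uniformContinuousOn_iff.1 hu (ε / 3) (by positivity)
  refine ⟨min δ 1, by positivity, fun t ht x => ?_⟩
  obtain ⟨τ, hτ, hτ'⟩ := hR (-x)
  have hτ1 : ‖x + τ‖ ≤ R := by simpa [add_comm] using hτ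
  have h1 : ‖x + t + τ‖ ≤ R + 1 := by
    rw [add_right_comm]
    exact (norm_add_le _ _).trans (add_le_add hτ1 (ht.trans_le (min_le_right _ _)).le)
  have h2 := h (x + t + τ) (by simpa using h1) (x + τ) (by simpa using hτ1.trans (by linarith))
    (by rw [dist_eq_norm]; simpa using ht.trans_le (min_le_left _ _))
  rw [dist_eq_norm] at h2
  have e : f (x + t) - f x = (f (x + t + τ) - f (x + τ)) - (f (x + t + τ) - f (x + t)) +
      (f (x + τ) - f x) := by abel
  rw [e]
  refine (norm_add_le _ _).trans ?_
  have := norm_sub_le (f (x + t + τ) - f (x + τ)) (f (x + t + τ) - f (x + t))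
  linarith [hτ' (x + t), hτ' x]

/-- The translation seminorm `t ↦ sup_x ‖f(x + t) - f(x)‖` of a bounded function. -/
noncomputable def translationSeminorm (f : V → E) (hb : ∃ B, ∀ x, ‖f x‖ ≤ B) :
    AddGroupSeminorm V :=
  have hbdd : ∀ t, BddAbove (Set.range fun x => ‖f (x + t) - f x‖) := fun t => by
    obtain ⟨B, hB⟩ := hb
    refine ⟨B + B, ?_⟩
    rintro _ ⟨x, rfl⟩
    exact (norm_sub_le _ _).trans (add_le_add (hB _) (hB _))
  { toFun := fun t => ⨆ x, ‖f (x + t) - f x‖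
    map_zero' := by simp
    add_le' := fun s t => ciSup_le fun x => by
      have e : f (x + (s + t)) - f x = (f (x + s + t) - f (x + s)) + (f (x + s) - f x) := by
        rw [← add_assoc]; abel
      rw [e]
      refine (norm_add_le _ _).trans ?_
      rw [add_comm]
      exact add_le_add (le_ciSup (hbdd s) x) (le_ciSup (hbdd t) (x + s))
    neg' := fun t => by
      refine le_antisymm (ciSup_le fun x => ?_) (ciSup_le fun x => ?_)
      · have := le_ciSup (hbdd t) (x + -t)
        simp only [neg_add_cancel_right] at this
        rwa [norm_sub_rev]
      · have := le_ciSup (hbdd (-t)) (x + t)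
        simp only [add_neg_cancel_right] at this
        rwa [norm_sub_rev] }

lemma le_translationSeminorm (hb : ∃ B, ∀ x, ‖f x‖ ≤ B) (t x : V) :
    ‖f (x + t) - f x‖ ≤ translationSeminorm f hb t := by
  refine le_ciSup (f := fun x => ‖f (x + t) - f x‖) ?_ x
  obtain ⟨B, hB⟩ := hb
  refine ⟨B + B, ?_⟩
  rintro _ ⟨x, rfl⟩
  exact (norm_sub_le _ _).trans (add_le_add (hB _) (hB _))

lemma translationSeminorm_le (hb : ∃ B, ∀ x, ‖f x‖ ≤ B) {t : V} {ε : ℝ}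
    (h : ∀ x, ‖f (x + t) - f x‖ ≤ ε) : translationSeminorm f hb t ≤ ε :=
  ciSup_le h

/-- The group `V` with the topology of a group seminorm. -/
def SeminormGroup (_ : AddGroupSeminorm V) : Type _ := V

noncomputable instance (p : AddGroupSeminorm V) : SeminormedAddCommGroup (SeminormGroup p) :=
  p.toSeminormedAddCommGroup (E := V)

/-- The identity map from `V` to `V` with the topology of a group seminorm. -/
def SeminormGroup.of (p : AddGroupSeminorm V) : V ≃+ SeminormGroup p := AddEquiv.refl V

/-- A continuous Bohr almost periodic function extends continuously to a compact group in which
`V` is dense, and the group can be chosen so small that only its zero leaves the extension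
invariant: it is the completion of `V` for the translation seminorm, which is totally bounded
because translations by almost periods are small. -/
theorem BohrAP.exists_compact_group {V : Type} [NormedAddCommGroup V] {f : V → E} [ProperSpace V]
    [CompleteSpace E] (hf : BohrAP f)
    (hc : Continuous f) :
    ∃ (G : Type) (_ : NormedAddCommGroup G) (_ : CompactSpace G) (ι : V →+ G) (F : C(G, E)),
      Continuous ι ∧ DenseRange ι ∧ (∀ x, F (ι x) = f x) ∧
      ∀ g, (∀ h, F (h + g) = F h) → g = 0 := by
  have hb := hf.bounded hc
  let p := translationSeminorm f hb
  let W := SeminormGroup p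
  let o : V ≃+ W := SeminormGroup.of p
  have hno : ∀ t, ‖o t‖ = p t := fun t => rfl
  have hoc : Continuous o := by
    refine continuous_of_continuousAt_zero o ?_
    rw [ContinuousAt, map_zero, Metric.tendsto_nhds_nhds]
    intro ε hε
    obtain ⟨δ, hδ, h⟩ := hf.uniform hc (half_pos hε)
    refine ⟨δ, hδ, fun {t} ht => ?_⟩
    rw [dist_zero_right] at ht ⊢
    rw [hno]
    exact (translationSeminorm_le hb (h t ht)).trans_lt (half_lt_self hε)
  have hdist : ∀ s t : V, ‖f s - f t‖ ≤ ‖o s - o t‖ := fun s t => by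
    rw [← map_sub, hno]
    simpa using le_translationSeminorm hb (s - t) t
  have htb : TotallyBounded (Set.univ : Set W) := by
    rw [Metric.totallyBounded_iff]
    intro ε hε
    obtain ⟨R, hR⟩ := hf (ε / 2 / 2) (by positivity)
    have hK : IsCompact (o '' Metric.closedBall (0 : V) R) :=
      (isCompact_closedBall (0 : V) R).image hoc
    obtain ⟨T, hT, hTc⟩ := Metric.totallyBounded_iff.1 hK.totallyBounded (ε / 2) (by positivity)
    refine ⟨T, hT, fun w _ => ?_⟩
    obtain ⟨t, rfl⟩ := o.surjective w
    obtain ⟨τ, hτ, h⟩ := hR t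
    have h1 := hTc ⟨t - τ, by simpa [norm_sub_rev] using hτ, rfl⟩
    simp only [Set.mem_iUnion, Metric.mem_ball] at h1 ⊢
    obtain ⟨y, hy, hy'⟩ := h1
    refine ⟨y, hy, ?_⟩
    have h2 : dist (o t) (o (t - τ)) ≤ ε / 2 / 2 := by
      rw [dist_eq_norm, ← map_sub, sub_sub_cancel, hno]
      exact translationSeminorm_le hb h
    calc dist (o t) y ≤ _ := dist_triangle _ (o (t - τ)) _
      _ < ε := by linarith
  let f' : W → E := fun w => f (o.symm w)
  have hf'l : ∀ a b, ‖f' a - f' b‖ ≤ ‖a - b‖ := fun a b => by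
    simpa using hdist (o.symm a) (o.symm b)
  have hf' : UniformContinuous f' := by
    refine LipschitzWith.uniformContinuous (K := 1) (LipschitzWith.of_dist_le_mul fun a b => ?_)
    rw [dist_eq_norm, dist_eq_norm]
    simpa using hf'l a b
  let F : C(UniformSpace.Completion W, E) :=
    ⟨UniformSpace.Completion.extension f', UniformSpace.Completion.continuous_extension⟩
  have hFc : ∀ w : W, F w = f' w := fun w => UniformSpace.Completion.extension_coe hf' w
  have hFl : ∀ a b, ‖F a - F b‖ ≤ ‖a - b‖ := by
    intro a b
    refine UniformSpace.Completion.induction_on₂ a b (isClosed_le (by fun_prop) (by fun_prop)) ?_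
    intro a b
    rw [hFc, hFc, ← UniformSpace.Completion.coe_sub, UniformSpace.Completion.norm_coe]
    exact hf'l a b
  refine ⟨UniformSpace.Completion W, inferInstance, ?_,
    UniformSpace.Completion.toCompl.comp (o : V →+ W), F, ?_, ?_, ?_, ?_⟩
  · constructor
    have h1 := (htb.image (UniformSpace.Completion.uniformContinuous_coe W)).closure
    rw [Set.image_univ, UniformSpace.Completion.denseRange_coe.closure_range] at h1
    exact isCompact_iff_totallyBounded_isComplete.2 ⟨h1, isComplete_univ⟩
  · exact (UniformSpace.Completion.continuous_coe W).comp hoc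
  · exact (UniformSpace.Completion.denseRange_coe (α := W)).comp o.surjective.denseRange
      (UniformSpace.Completion.continuous_coe W)
  · intro x
    change F (o x : W) = f x
    rw [hFc]; simp [f']
  · intro g hg
    rw [← norm_eq_zero]
    by_contra hne
    have hpos : 0 < ‖g‖ := lt_of_le_of_ne (norm_nonneg _) (Ne.symm hne)
    obtain ⟨w, hw⟩ := (UniformSpace.Completion.denseRange_coe (α := W)).exists_dist_lt g
      (half_pos hpos)
    rw [dist_eq_norm] at hw
    obtain ⟨v, rfl⟩ := o.surjective w
    have h1 : p v ≤ ‖g - (o v : UniformSpace.Completion W)‖ := by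
      refine translationSeminorm_le hb fun x => ?_
      have e1 : f (x + v) = F ((o x : UniformSpace.Completion W) + (o v : W)) := by
        rw [← UniformSpace.Completion.coe_add, hFc, ← map_add]; simp [f']
      have e2 : f x = F ((o x : UniformSpace.Completion W) + g) := by
        rw [hg, hFc]; simp [f']
      rw [e1, e2]
      refine (hFl _ _).trans ?_
      rw [norm_sub_rev]
      simp
    have h2 : ‖(o v : UniformSpace.Completion W)‖ = p v := by
      rw [UniformSpace.Completion.norm_coe, hno]
    have h3 := norm_sub_norm_le g (o v : UniformSpace.Completion W)
    linarith

end Hull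

/-! ### Exponentials, mean values and Fourier-Bohr coefficients -/

section Means

variable {n : ℕ}

/-- The continuous character `x ↦ e^{i⟨x, l⟩}` of `ℝⁿ`. -/
noncomputable def ew (l x : Fin n → ℝ) : ℂ := Complex.exp (Complex.I * ((x ⬝ᵥ l : ℝ) : ℂ))

lemma ew_add_freq (l l' x : Fin n → ℝ) : ew (l + l') x = ew l x * ew l' x := by
  rw [ew, ew, ew, ← Complex.exp_add, dotProduct_add]; push_cast; ring_nf

lemma ew_add (l x y : Fin n → ℝ) : ew l (x + y) = ew l x * ew l y := by
  rw [ew, ew, ew, ← Complex.exp_add, add_dotProduct]; push_cast; ring_nf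

@[simp] lemma ew_zero_freq (x : Fin n → ℝ) : ew 0 x = 1 := by simp [ew]

@[simp] lemma ew_zero (l : Fin n → ℝ) : ew l 0 = 1 := by simp [ew]

@[simp] lemma norm_ew (l x : Fin n → ℝ) : ‖ew l x‖ = 1 := by
  rw [ew, mul_comm]; exact Complex.norm_exp_ofReal_mul_I _

lemma conj_ew (l x : Fin n → ℝ) : starRingEnd ℂ (ew l x) = ew (-l) x := by
  rw [ew, ew, ← Complex.exp_conj]; simp

@[fun_prop] lemma continuous_ew (l : Fin n → ℝ) : Continuous (ew l) := by
  unfold ew; fun_prop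

/-- The mean of `f` over the box `|x_k| < s`. -/
noncomputable def boxMean (f : (Fin n → ℝ) → ℂ) (s : ℝ) : ℂ :=
  (1 / ((2 * s) ^ n : ℝ) : ℂ) * ∫ x in {x : Fin n → ℝ | ∀ k, |x k| < s}, f x

lemma box_eq_pi (s : ℝ) :
    {x : Fin n → ℝ | ∀ k, |x k| < s} = Set.univ.pi fun _ => Set.Ioo (-s) s := by
  ext x; simp [abs_lt]

lemma volume_box {s : ℝ} (hs : 0 < s) :
    (volume {x : Fin n → ℝ | ∀ k, |x k| < s}).toReal = (2 * s) ^ n := by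
  rw [box_eq_pi, Real.volume_pi_Ioo]
  simp only [sub_neg_eq_add, Finset.prod_const, Finset.card_univ, Fintype.card_fin]
  rw [ENNReal.toReal_pow, ENNReal.toReal_ofReal (by linarith), two_mul]

lemma volume_box_lt_top (s : ℝ) : volume {x : Fin n → ℝ | ∀ k, |x k| < s} < ⊤ := by
  rw [box_eq_pi, Real.volume_pi_Ioo]
  exact ENNReal.prod_lt_top fun _ _ => ENNReal.ofReal_lt_top

lemma integrableOn_box {f : (Fin n → ℝ) → ℂ} (hf : Continuous f) (s : ℝ) :
    IntegrableOn f {x : Fin n → ℝ | ∀ k, |x k| < s} := by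
  refine (hf.continuousOn.integrableOn_compact
    (isCompact_univ_pi fun _ : Fin n => isCompact_Icc (a := -s) (b := s))).mono_set ?_
  rw [box_eq_pi]
  exact Set.pi_mono fun _ _ => Set.Ioo_subset_Icc_self

lemma norm_boxMean_le {f : (Fin n → ℝ) → ℂ} {C s : ℝ} (hs : 0 < s) (hf : ∀ x, ‖f x‖ ≤ C) :
    ‖boxMean f s‖ ≤ C := by
  have h1 := norm_setIntegral_le_of_norm_le_const (volume_box_lt_top (n := n) s)
    (fun x _ => hf x)
  rw [Measure.real, volume_box hs] at h1
  have hp : 0 < (2 * s) ^ n := by positivity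
  rw [boxMean, norm_mul, norm_div, norm_one, Complex.norm_real,
    Real.norm_of_nonneg hp.le, one_div, inv_mul_le_iff₀ hp]
  linarith

lemma boxMean_add {f g : (Fin n → ℝ) → ℂ} (hf : Continuous f) (hg : Continuous g) (s : ℝ) :
    boxMean (fun x => f x + g x) s = boxMean f s + boxMean g s := by
  rw [boxMean, integral_add (integrableOn_box hf s) (integrableOn_box hg s), mul_add]; rfl

lemma boxMean_sub {f g : (Fin n → ℝ) → ℂ} (hf : Continuous f) (hg : Continuous g) (s : ℝ) :
    boxMean (fun x => f x - g x) s = boxMean f s - boxMean g s := by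
  rw [boxMean, integral_sub (integrableOn_box hf s) (integrableOn_box hg s), mul_sub]; rfl

lemma boxMean_const_mul (f : (Fin n → ℝ) → ℂ) (c : ℂ) (s : ℝ) :
    boxMean (fun x => c * f x) s = c * boxMean f s := by
  rw [boxMean, integral_const_mul, boxMean]; ring

/-- `c` is the mean value of `f`. -/
def HasMean (f : (Fin n → ℝ) → ℂ) (c : ℂ) : Prop := Tendsto (boxMean f) atTop (𝓝 c)

/-- The one-dimensional means of `e^{iat}`. -/
lemma tendsto_mean_exp (a : ℝ) :
    Tendsto (fun s : ℝ => (1 / (2 * s : ℝ) : ℂ) *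
      ∫ x in Set.Ioo (-s) s, Complex.exp (Complex.I * ((x * a : ℝ) : ℂ))) atTop
      (𝓝 (if a = 0 then 1 else 0)) := by
  split_ifs with h
  · refine tendsto_const_nhds.congr' ?_
    filter_upwards [eventually_gt_atTop 0] with s hs
    simp only [h, mul_zero, Complex.ofReal_zero, Complex.exp_zero]
    rw [setIntegral_const, Measure.real, Real.volume_Ioo, ENNReal.toReal_ofReal (by linarith)]
    have : (s : ℂ) ≠ 0 := by exact_mod_cast hs.ne'
    simp; field_simp; norm_num
  · have hc : Complex.I * (a : ℂ) ≠ 0 := mul_ne_zero Complex.I_ne_zero (by exact_mod_cast h)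
    have hlim : Tendsto (fun s : ℝ => (1 / |a|) * s⁻¹) atTop (𝓝 0) := by
      simpa using tendsto_inv_atTop_zero.const_mul (1 / |a|)
    refine squeeze_zero_norm' ?_ hlim
    filter_upwards [eventually_gt_atTop 0] with s hs
    rw [← integral_Ioc_eq_integral_Ioo, ← intervalIntegral.integral_of_le (by linarith)]
    have e : ∀ x : ℝ, Complex.exp (Complex.I * ((x * a : ℝ) : ℂ)) =
        Complex.exp (Complex.I * (a : ℂ) * x) := fun x => by push_cast; ring_nf
    simp only [e]
    rw [integral_exp_mul_complex hc, norm_mul, norm_div, norm_div, norm_one, norm_mul,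
      Complex.norm_I, one_mul, Complex.norm_real, Complex.norm_real,
      Real.norm_of_nonneg (show 0 ≤ 2 * s by positivity), Real.norm_eq_abs]
    have h1 : ∀ y : ℝ, ‖Complex.exp (Complex.I * (a : ℂ) * y)‖ = 1 := fun y => by
      rw [show Complex.I * (a : ℂ) * y = ((a * y : ℝ) : ℂ) * Complex.I by push_cast; ring]
      exact Complex.norm_exp_ofReal_mul_I _
    have h2 := norm_sub_le (Complex.exp (Complex.I * (a : ℂ) * s))
      (Complex.exp (Complex.I * (a : ℂ) * (-s : ℝ)))
    rw [h1, h1] at h2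
    have ha : 0 < |a| := abs_pos.2 h
    calc _ ≤ 1 / (2 * s) * ((1 + 1) / |a|) := by gcongr
      _ = 1 / |a| * s⁻¹ := by field_simp; norm_num

lemma boxMean_ew (l : Fin n → ℝ) (s : ℝ) :
    boxMean (ew l) s = ∏ k, ((1 / (2 * s : ℝ) : ℂ) *
      ∫ x in Set.Ioo (-s) s, Complex.exp (Complex.I * ((x * l k : ℝ) : ℂ))) := by
  rw [Finset.prod_mul_distrib, ← integral_fintype_prod_eq_prod, boxMean, box_eq_pi, volume_pi,
    Measure.restrict_pi_pi]
  congr 1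
  · rw [Finset.prod_const, Finset.card_univ, Fintype.card_fin, one_div, one_div, inv_pow]
    push_cast
    rfl
  · congr 1; ext x
    rw [ew, ← Complex.exp_sum, dotProduct, Complex.ofReal_sum, Finset.mul_sum]

lemma hasMean_ew (l : Fin n → ℝ) : HasMean (ew l) (if l = 0 then 1 else 0) := by
  have h := tendsto_finsetProd (Finset.univ : Finset (Fin n)) fun k _ => tendsto_mean_exp (l k)
  have e : (∏ k, if l k = 0 then (1 : ℂ) else 0) = if l = 0 then 1 else 0 := by
    split_ifs with h0
    · simp [h0]
    · obtain ⟨k, hk⟩ := Function.ne_iff.1 h0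
      exact Finset.prod_eq_zero (Finset.mem_univ k) (if_neg hk)
  rw [e] at h
  exact h.congr fun s => (boxMean_ew l s).symm

/-- Uniform limits of trigonometric polynomials on `ℝⁿ`. -/
def UAP (f : (Fin n → ℝ) → ℂ) : Prop :=
  ∀ ε > 0, ∃ (ι : Type) (_ : Fintype ι) (l : ι → Fin n → ℝ) (c : ι → ℂ),
    ∀ x, ‖f x - ∑ i, c i * ew (l i) x‖ ≤ ε

lemma uap_trigPoly {ι : Type} [Fintype ι] (l : ι → Fin n → ℝ) (c : ι → ℂ) :
    UAP fun x => ∑ i, c i * ew (l i) x :=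
  fun ε hε => ⟨ι, inferInstance, l, c, fun x => by simpa using hε.le⟩

variable {f g : (Fin n → ℝ) → ℂ}

lemma UAP.continuous (hf : UAP f) : Continuous f := by
  refine continuous_of_uniform_approx_of_continuous fun u hu => ?_
  obtain ⟨ε, hε, h⟩ := Metric.mem_uniformity_dist.1 hu
  obtain ⟨ι, _, l, c, hlc⟩ := hf (ε / 2) (by positivity)
  refine ⟨fun x => ∑ i, c i * ew (l i) x, by fun_prop, fun x => h ?_⟩
  rw [dist_eq_norm]
  linarith [hlc x]

lemma UAP.add (hf : UAP f) (hg : UAP g) : UAP fun x => f x + g x := by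
  intro ε hε
  obtain ⟨ι, _, l, c, h⟩ := hf (ε / 2) (by positivity)
  obtain ⟨κ, _, l', c', h'⟩ := hg (ε / 2) (by positivity)
  refine ⟨ι ⊕ κ, inferInstance, Sum.elim l l', Sum.elim c c', fun x => ?_⟩
  simp only [Fintype.sum_sum_type, Sum.elim_inl, Sum.elim_inr]
  rw [add_sub_add_comm]
  exact (norm_add_le _ _).trans (by linarith [h x, h' x])

lemma UAP.const_mul (hf : UAP f) (a : ℂ) : UAP fun x => a * f x := by
  intro ε hε
  obtain ⟨ι, _, l, c, h⟩ := hf (ε / (‖a‖ + 1)) (by positivity)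
  refine ⟨ι, inferInstance, l, fun i => a * c i, fun x => ?_⟩
  have e : a * f x - ∑ i, a * c i * ew (l i) x = a * (f x - ∑ i, c i * ew (l i) x) := by
    rw [mul_sub, Finset.mul_sum]; simp only [mul_assoc]
  rw [e, norm_mul]
  calc ‖a‖ * ‖f x - ∑ i, c i * ew (l i) x‖ ≤ (‖a‖ + 1) * (ε / (‖a‖ + 1)) := by
        gcongr
        · linarith
        · exact h x
    _ = ε := by field_simp

lemma UAP.ew_mul (hf : UAP f) (l₀ : Fin n → ℝ) : UAP fun x => ew l₀ x * f x := by
  intro ε hε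
  obtain ⟨ι, _, l, c, h⟩ := hf ε hε
  refine ⟨ι, inferInstance, fun i => l₀ + l i, c, fun x => ?_⟩
  have e : ew l₀ x * f x - ∑ i, c i * ew (l₀ + l i) x =
      ew l₀ x * (f x - ∑ i, c i * ew (l i) x) := by
    rw [mul_sub, Finset.mul_sum]
    congr 1
    exact Finset.sum_congr rfl fun i _ => by rw [ew_add_freq]; ring
  rw [e, norm_mul, norm_ew, one_mul]
  exact h x

lemma UAP.sub (hf : UAP f) (hg : UAP g) : UAP fun x => f x - g x := by
  simpa [sub_eq_add_neg] using hf.add (hg.const_mul (-1))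

lemma HasMean.add {a b : ℂ} (hf : Continuous f) (hg : Continuous g) (ha : HasMean f a)
    (hb : HasMean g b) : HasMean (fun x => f x + g x) (a + b) :=
  (Tendsto.add ha hb).congr fun s => (boxMean_add hf hg s).symm

lemma HasMean.const_mul {a : ℂ} (ha : HasMean f a) (c : ℂ) :
    HasMean (fun x => c * f x) (c * a) :=
  (Tendsto.const_mul c ha).congr fun s => (boxMean_const_mul f c s).symm

lemma HasMean.sum {κ : Type*} (s : Finset κ) {f : κ → (Fin n → ℝ) → ℂ} {a : κ → ℂ}
    (hc : ∀ i ∈ s, Continuous (f i)) (hf : ∀ i ∈ s, HasMean (f i) (a i)) :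
    HasMean (fun x => ∑ i ∈ s, f i x) (∑ i ∈ s, a i) := by
  classical
  induction s using Finset.induction_on with
  | empty => 
    have : boxMean (fun _ : Fin n → ℝ => (0 : ℂ)) = fun _ => 0 := by ext s; simp [boxMean]
    simp [HasMean, this]
  | insert a s ha ih =>
    simp only [Finset.sum_insert ha]
    refine HasMean.add (hc a (Finset.mem_insert_self a s)) ?_ (hf a (Finset.mem_insert_self a s))
      (ih (fun i hi => hc i (Finset.mem_insert_of_mem hi))
        fun i hi => hf i (Finset.mem_insert_of_mem hi))
    exact continuous_finsetSum _ fun i hi => hc i (Finset.mem_insert_of_mem hi)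

lemma HasMean.norm_le {a : ℂ} {C : ℝ} (ha : HasMean f a) (hf : ∀ x, ‖f x‖ ≤ C) : ‖a‖ ≤ C := by
  refine le_of_tendsto ha.norm ?_
  filter_upwards [eventually_gt_atTop 0] with s hs
  exact norm_boxMean_le hs hf

lemma HasMean.norm_le_of_weight {a b : ℂ} {C : ℝ} {k : (Fin n → ℝ) → ℝ} (hk : ∀ x, 0 ≤ k x)
    (hkc : Continuous k) (hb : HasMean (fun x => (k x : ℂ)) b) (ha : HasMean f a)
    (hf : ∀ x, ‖f x‖ ≤ C * k x) : ‖a‖ ≤ C * ‖b‖ := by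
  refine le_of_tendsto_of_tendsto ha.norm (hb.norm.const_mul C) ?_
  filter_upwards [eventually_gt_atTop 0] with s hs
  rw [boxMean, boxMean, norm_mul, norm_mul, mul_left_comm]
  gcongr
  have hki : IntegrableOn k {x : Fin n → ℝ | ∀ k, |x k| < s} := by
    have := (integrableOn_box (f := fun x => (k x : ℂ)) (by fun_prop) s).re
    simpa [IntegrableOn] using this
  calc _ ≤ ∫ x in {x : Fin n → ℝ | ∀ k, |x k| < s}, C * k x :=
        norm_integral_le_of_norm_le (hki.const_mul C) (Eventually.of_forall hf)
    _ = _ := by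
      rw [integral_const_mul, integral_complex_ofReal, Complex.norm_real,
        Real.norm_of_nonneg (integral_nonneg hk)]

lemma hasMean_trigPoly {ι : Type*} [Fintype ι] (l : ι → Fin n → ℝ) (c : ι → ℂ) :
    HasMean (fun x => ∑ i, c i * ew (l i) x) (∑ i, c i * if l i = 0 then 1 else 0) :=
  HasMean.sum _ (fun i _ => by fun_prop) fun i _ => (hasMean_ew (l i)).const_mul (c i)

lemma UAP.exists_hasMean (hf : UAP f) : ∃ a, HasMean f a := by
  refine CompleteSpace.complete (f := map (boxMean f) atTop)
    (Metric.cauchy_iff.2 ⟨inferInstance, fun ε hε => ?_⟩)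
  obtain ⟨ι, _, l, c, h⟩ := hf (ε / 4) (by positivity)
  have hP := hasMean_trigPoly l c
  have := Metric.tendsto_nhds.1 hP (ε / 4) (by positivity)
  set b := ∑ i, c i * if l i = 0 then (1 : ℂ) else 0
  have hev : ∀ᶠ s in atTop, boxMean f s ∈ Metric.ball b (ε / 2) := by
    filter_upwards [this, eventually_gt_atTop 0] with s hs hs0
    have h1 := norm_boxMean_le hs0 h
    rw [boxMean_sub hf.continuous (by fun_prop)] at h1
    rw [Metric.mem_ball]
    refine (dist_triangle _ _ _).trans_lt (add_lt_add_of_le_of_lt ((dist_eq_norm _ _).trans_le h1)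
      hs |>.trans_eq (by ring))
  refine ⟨_, hev, fun x hx y hy => ?_⟩
  rw [Metric.mem_ball] at hx hy
  have := dist_triangle_right x y b
  linarith

/-- The mean value of an almost periodic function. -/
noncomputable def mean (f : (Fin n → ℝ) → ℂ) : ℂ := limUnder atTop (boxMean f)

lemma HasMean.mean_eq {a : ℂ} (h : HasMean f a) : mean f = a := Tendsto.limUnder_eq h

lemma UAP.hasMean (hf : UAP f) : HasMean f (mean f) := by
  obtain ⟨a, ha⟩ := hf.exists_hasMean
  rwa [ha.mean_eq]

lemma UAP.norm_mean_le (hf : UAP f) {C : ℝ} (h : ∀ x, ‖f x‖ ≤ C) : ‖mean f‖ ≤ C :=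
  hf.hasMean.norm_le h

lemma UAP.mean_sub (hf : UAP f) (hg : UAP g) :
    mean (fun x => f x - g x) = mean f - mean g :=
  HasMean.mean_eq ((Tendsto.sub hf.hasMean hg.hasMean).congr fun s =>
    (boxMean_sub hf.continuous hg.continuous s).symm)

/-- The mean of `e_{-l} f`: the Fourier-Bohr coefficient of `f` at the frequency `l`. -/
noncomputable def coeff (f : (Fin n → ℝ) → ℂ) (l : Fin n → ℝ) : ℂ := mean fun x => ew (-l) x * f x

lemma UAP.hasMean_coeff (hf : UAP f) (l : Fin n → ℝ) :
    HasMean (fun x => ew (-l) x * f x) (coeff f l) := (hf.ew_mul (-l)).hasMean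

lemma coeff_trigPoly {ι : Type*} [Fintype ι] (l : ι → Fin n → ℝ) (c : ι → ℂ) (l₀ : Fin n → ℝ) :
    coeff (fun x => ∑ i, c i * ew (l i) x) l₀ = ∑ i, c i * if l i = l₀ then 1 else 0 := by
  have := (hasMean_trigPoly (fun i => l i - l₀) c).mean_eq
  simp only [sub_eq_zero] at this
  rw [← this, coeff]
  congr 1; ext x
  rw [Finset.mul_sum]
  exact Finset.sum_congr rfl fun i _ => by rw [sub_eq_add_neg, ew_add_freq]; ring

lemma UAP.coeff_sub (hf : UAP f) (hg : UAP g) (l : Fin n → ℝ) :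
    coeff (fun x => f x - g x) l = coeff f l - coeff g l := by
  rw [coeff, coeff, coeff, ← (hf.ew_mul (-l)).mean_sub (hg.ew_mul (-l))]
  congr 1; ext x; ring

lemma UAP.norm_coeff_le (hf : UAP f) {C : ℝ} (h : ∀ x, ‖f x‖ ≤ C) (l : Fin n → ℝ) :
    ‖coeff f l‖ ≤ C :=
  (hf.ew_mul (-l)).norm_mean_le fun x => by simpa using h x

end Means

/-! ### Continuous characters of `ℝⁿ` -/

section Characters

lemma addChar_map_sum {ι A M : Type*} [AddCommMonoid A] [CommMonoid M] (χ : AddChar A M)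
    (s : Finset ι) (a : ι → A) : χ (∑ i ∈ s, a i) = ∏ i ∈ s, χ (a i) := by
  classical
  induction s using Finset.induction_on with
  | empty => simp
  | insert i s hi ih => rw [Finset.sum_insert hi, Finset.prod_insert hi, χ.map_add_eq_mul, ih]

lemma circle_coe_prod {ι : Type*} (s : Finset ι) (u : ι → Circle) :
    ((∏ i ∈ s, u i : Circle) : ℂ) = ∏ i ∈ s, (u i : ℂ) := map_prod Circle.coeHom u s

/-- Continuous characters of `ℝ`: the integral relation `κ(t) ∫₀ᵃ κ = ∫ₜ^{t+a} κ` makes `κ`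
differentiable with `κ' = c κ`. -/
lemma exists_eq_exp_of_continuous (κ : AddChar ℝ Circle) (hκ : Continuous κ) :
    ∃ a : ℝ, ∀ t, (κ t : ℂ) = Complex.exp (Complex.I * ((t * a : ℝ) : ℂ)) := by
  let ψ : ℝ → ℂ := fun t => κ t
  have hψ : Continuous ψ := by fun_prop
  have hadd : ∀ s t, ψ (s + t) = ψ s * ψ t := fun s t => by simp [ψ, AddChar.map_add_eq_mul]
  have hψ0 : ψ 0 = 1 := by simp [ψ]
  let Φ : ℝ → ℂ := fun t => ∫ s in (0 : ℝ)..t, ψ s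
  have hΦ : ∀ t, HasDerivAt Φ (ψ t) t := fun t => hψ.integral_hasStrictDerivAt 0 t |>.hasDerivAt
  obtain ⟨a, ha⟩ : ∃ a, Φ a ≠ 0 := by
    by_contra! h
    have h1 := hΦ 0
    rw [show Φ = fun _ => 0 from funext h, hψ0] at h1
    exact one_ne_zero (h1.unique (hasDerivAt_const _ _))
  have hrel : ∀ t, ψ t = (Φ (t + a) - Φ t) / Φ a := fun t => by
    rw [eq_div_iff ha]
    have h1 : Φ (t + a) - Φ t = ∫ s in t..(t + a), ψ s :=
      intervalIntegral.integral_interval_sub_left (hψ.intervalIntegrable _ _)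
        (hψ.intervalIntegrable _ _)
    have h2 := intervalIntegral.integral_comp_add_left (a := 0) (b := a) ψ t
    rw [add_zero] at h2
    rw [h1, ← h2]
    simp only [hadd, intervalIntegral.integral_const_mul, Φ]
  let c := (ψ a - 1) / Φ a
  have hder : ∀ t, HasDerivAt ψ (c * ψ t) t := fun t => by
    have h1 : HasDerivAt (fun t => (Φ (t + a) - Φ t) / Φ a) ((ψ (t + a) - ψ t) / Φ a) t :=
      (((hΦ (t + a)).comp_add_const t a).sub (hΦ t)).div_const _
    rw [← funext hrel, hadd] at h1
    convert h1 using 1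
    simp only [c]; ring
  have hexp : ∀ t, ψ t = Complex.exp (c * t) := fun t => by
    have hE : ∀ t : ℝ, HasDerivAt (fun t : ℝ => Complex.exp (-(c * t)))
        (Complex.exp (-(c * t)) * -(c * 1)) t := fun t =>
      (((Complex.ofRealCLM.hasDerivAt (x := t)).const_mul c).neg).cexp
    have hd : ∀ t, HasDerivAt (fun t : ℝ => ψ t * Complex.exp (-(c * t))) 0 t := fun t =>
      ((hder t).mul (hE t)).congr_deriv (by ring)
    have := is_const_of_deriv_eq_zero (fun t => (hd t).differentiableAt) (fun t => (hd t).deriv)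
      t 0
    simp only [hψ0, Complex.ofReal_zero, mul_zero, neg_zero, Complex.exp_zero, mul_one] at this
    rw [Complex.exp_neg] at this
    field_simp at this
    exact this
  have hre : c.re = 0 := by
    have h1 : ‖ψ 1‖ = 1 := Circle.norm_coe _
    rw [hexp, Complex.norm_exp] at h1
    simpa using h1
  refine ⟨c.im, fun t => (hexp t).trans ?_⟩
  have hcI : c = c.im * Complex.I := by
    apply Complex.ext <;> simp [hre]
  rw [hcI]; push_cast; simp; ring_nf

variable {n : ℕ}

/-- The continuous characters of `ℝⁿ` are the exponentials. -/
lemma exists_eq_ew_of_continuous (κ : AddChar (Fin n → ℝ) Circle) (hκ : Continuous κ) :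
    ∃ l : Fin n → ℝ, ∀ x, (κ x : ℂ) = ew l x := by
  have h : ∀ k : Fin n, ∃ a : ℝ, ∀ t : ℝ, (κ (Pi.single k t) : ℂ) =
      Complex.exp (Complex.I * ((t * a : ℝ) : ℂ)) := fun k =>
    exists_eq_exp_of_continuous
      (κ.compAddMonoidHom (AddMonoidHom.single (fun _ : Fin n => ℝ) k))
      (hκ.comp (continuous_single (A := fun _ : Fin n => ℝ) k))
  choose l hl using h
  refine ⟨l, fun x => ?_⟩
  conv_lhs => rw [← Finset.univ_sum_single x, addChar_map_sum]
  rw [circle_coe_prod, ew, dotProduct, Complex.ofReal_sum, Finset.mul_sum, Complex.exp_sum]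
  exact Finset.prod_congr rfl fun k _ => hl k (x k)

lemma exists_ew_ne_one {l : Fin n → ℝ} (hl : l ≠ 0) : ∃ x, ew l x ≠ 1 := by
  by_contra! h
  have h1 := hasMean_ew l
  have h2 := hasMean_ew (0 : Fin n → ℝ)
  rw [if_neg hl] at h1
  rw [if_pos rfl] at h2
  have : ew l = ew 0 := by ext x; rw [h, ew_zero_freq]
  rw [this] at h1
  exact one_ne_zero (tendsto_nhds_unique h2 h1)

end Characters

/-! ### Density of character sums on the compact group -/

section Approximation

open scoped ComplexConjugate

variable {n : ℕ} {G : Type} [NormedAddCommGroup G]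

/-- The continuous character `χ` of `G` restricts to the character `e_l` of `ℝⁿ`. -/
def RestrictsTo (j : (Fin n → ℝ) →+ G) (χ : AddChar G Circle) (l : Fin n → ℝ) : Prop :=
  Continuous χ ∧ ∀ x, (χ (j x) : ℂ) = ew l x

variable {j : (Fin n → ℝ) →+ G} {χ χ' : AddChar G Circle} {l l' : Fin n → ℝ}

lemma exists_restrictsTo (hj : Continuous j) (hχ : Continuous χ) : ∃ l, RestrictsTo j χ l := by
  obtain ⟨l, hl⟩ := exists_eq_ew_of_continuous (χ.compAddMonoidHom j) (hχ.comp hj)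
  exact ⟨l, hχ, hl⟩

lemma RestrictsTo.mul (h : RestrictsTo j χ l) (h' : RestrictsTo j χ' l') :
    RestrictsTo j (χ * χ') (l + l') :=
  ⟨h.1.mul h'.1, fun x => by
    rw [AddChar.mul_apply, Circle.coe_mul, h.2, h'.2, ew_add_freq]⟩

lemma RestrictsTo.inv (h : RestrictsTo j χ l) : RestrictsTo j χ⁻¹ (-l) :=
  ⟨h.1.comp continuous_neg, fun x => by
    rw [AddChar.inv_apply', Circle.coe_inv_eq_conj, h.2, conj_ew]⟩

lemma restrictsTo_one : RestrictsTo j 1 0 :=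
  ⟨continuous_const, fun x => by simp⟩

lemma conj_eq_inv_apply (χ : AddChar G Circle) (g : G) : conj (χ g : ℂ) = (χ⁻¹ g : Circle) := by
  rw [AddChar.inv_apply', Circle.coe_inv_eq_conj]

variable [MeasurableSpace G] [BorelSpace G] (μ : Measure G)
  [IsProbabilityMeasure μ] [μ.IsAddHaarMeasure]

lemma RestrictsTo.integral (h : RestrictsTo j χ l) (hd : DenseRange j) :
    ∫ g, (χ g : ℂ) ∂μ = if l = 0 then 1 else 0 := by
  split_ifs with hl
  · have : (fun g => (χ g : ℂ)) = fun _ => 1 := by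
      refine hd.equalizer (by have := h.1; fun_prop) continuous_const ?_
      ext x; simp [h.2, hl]
    simp [this]
  · obtain ⟨x, hx⟩ := exists_ew_ne_one hl
    have h1 : ∫ g, (χ g : ℂ) ∂μ = ew l x * ∫ g, (χ g : ℂ) ∂μ := by
      conv_lhs => rw [← integral_add_right_eq_self _ (j x)]
      rw [← integral_const_mul]
      congr 1; ext g
      rw [AddChar.map_add_eq_mul, Circle.coe_mul, h.2, mul_comm]
    have h2 : (ew l x - 1) * ∫ g, (χ g : ℂ) ∂μ = 0 := by linear_combination -h1
    exact (mul_eq_zero.1 h2).resolve_left (sub_ne_zero.2 hx)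

variable [CompactSpace G] {K : Type} [MetricSpace K] [CompactSpace K]

/-- Finite sums `∑ k_i(y) χ_i(g)` on `G × K` whose characters `χ_i` restrict on `ℝⁿ` to
exponentials with frequencies in the group `Γ`. -/
def charSums (j : (Fin n → ℝ) →+ G) (Γ : AddSubgroup (Fin n → ℝ)) (K : Type) [MetricSpace K]
    [CompactSpace K] :
    StarSubalgebra ℂ C(G × K, ℂ) where
  carrier := {Φ | ∃ (ι : Type) (_ : Fintype ι) (χ : ι → AddChar G Circle) (l : ι → Fin n → ℝ)
    (k : ι → C(K, ℂ)), (∀ i, RestrictsTo j (χ i) (l i)) ∧ (∀ i, l i ∈ Γ) ∧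
    ∀ p, Φ p = ∑ i, k i p.2 * χ i p.1}
  add_mem' := by
    rintro Φ Ψ ⟨ι, _, χ, l, k, h1, h2, h3⟩ ⟨ι', _, χ', l', k', h1', h2', h3'⟩
    refine ⟨ι ⊕ ι', inferInstance, Sum.elim χ χ', Sum.elim l l', Sum.elim k k', ?_, ?_, ?_⟩
    · rintro (i | i)
      exacts [h1 i, h1' i]
    · rintro (i | i)
      exacts [h2 i, h2' i]
    · intro p
      simp [h3, h3']
  mul_mem' := by
    rintro Φ Ψ ⟨ι, _, χ, l, k, h1, h2, h3⟩ ⟨ι', _, χ', l', k', h1', h2', h3'⟩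
    refine ⟨ι × ι', inferInstance, fun i => χ i.1 * χ' i.2, fun i => l i.1 + l' i.2,
      fun i => k i.1 * k' i.2, fun i => (h1 _).mul (h1' _), fun i => Γ.add_mem (h2 _) (h2' _),
      fun p => ?_⟩
    rw [ContinuousMap.mul_apply, h3, h3', Finset.sum_mul_sum, ← Finset.sum_product']
    refine Finset.sum_congr rfl fun i _ => ?_
    simp only [ContinuousMap.mul_apply, AddChar.mul_apply, Circle.coe_mul]
    ring
  algebraMap_mem' := fun c => ⟨Unit, inferInstance, fun _ => 1, fun _ => 0,
    fun _ => ContinuousMap.const K c, fun _ => restrictsTo_one, fun _ => Γ.zero_mem, fun p => by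
      simp [Algebra.algebraMap_eq_smul_one]⟩
  star_mem' := by
    rintro Φ ⟨ι, _, χ, l, k, h1, h2, h3⟩
    refine ⟨ι, inferInstance, fun i => (χ i)⁻¹, fun i => -l i, fun i => star (k i),
      fun i => (h1 i).inv, fun i => Γ.neg_mem (h2 i), fun p => ?_⟩
    simp only [ContinuousMap.star_apply, h3, star_sum, star_mul', ← conj_eq_inv_apply]
    rfl

/-- If only `0` leaves `F` invariant, then the characters having a nonzero Fourier coefficient
separate the points of `G`, so that by the Stone-Weierstrass theorem `F` is a uniform limit of
sums over the group they generate. -/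
lemma exists_charSum_near (hj : Continuous j) {F : C(G, C(K, ℂ))}
    (hF : ∀ g, (∀ h, F (h + g) = F h) → g = 0) {Γ : AddSubgroup (Fin n → ℝ)}
    (hΓ : ∀ χ l, RestrictsTo j χ l → (∃ y, ∫ g, F g y * conj (χ g : ℂ) ∂μ ≠ 0) → l ∈ Γ)
    {ε : ℝ} (hε : 0 < ε) :
    ∃ (ι : Type) (_ : Fintype ι) (χ : ι → AddChar G Circle) (l : ι → Fin n → ℝ)
      (k : ι → C(K, ℂ)), (∀ i, RestrictsTo j (χ i) (l i)) ∧ (∀ i, l i ∈ Γ) ∧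
      ∀ g y, ‖F g y - ∑ i, k i y * χ i g‖ ≤ ε := by
  have hsep : (charSums j Γ K).SeparatesPoints := by
    rintro ⟨g, y⟩ ⟨g', y'⟩ hne
    by_cases hgg : g = g'
    · have hyy : y ≠ y' := fun h => hne (by rw [hgg, h])
      let k : C(K, ℂ) := ⟨fun z => (dist z y : ℂ), by fun_prop⟩
      refine ⟨_, ⟨(⟨fun p => k p.2, by fun_prop⟩ : C(G × K, ℂ)), ⟨Unit, inferInstance, fun _ => 1,
        fun _ => 0, fun _ => k, fun _ => restrictsTo_one, fun _ => Γ.zero_mem, ?_⟩, rfl⟩, ?_⟩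
      · intro p; simp
      · simp [k, hyy.symm, eq_comm]
    · have h1 : ∃ h y, F (h + (g - g')) y ≠ F h y := by
        by_contra! h1
        exact hgg (sub_eq_zero.1 (hF _ fun h => ContinuousMap.ext fun y => h1 h y))
      obtain ⟨h, y, h1⟩ := h1
      have hFy : Continuous fun t => F t y := (continuous_eval_const y).comp F.continuous
      let u : C(G, ℂ) := ⟨fun t => F (t + (g - g')) y - F t y,
        (hFy.comp (continuous_add_const _)).sub hFy⟩
      have hu : u ≠ 0 := fun h0 => h1 (sub_eq_zero.1 (DFunLike.congr_fun h0 h))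
      have h2 : ∃ χ : AddChar G Circle, Continuous χ ∧ ∫ t, u t * conj (χ t : ℂ) ∂μ ≠ 0 := by
        by_contra! h2
        exact hu (eq_zero_of_fourier_eq_zero μ u h2)
      obtain ⟨χ, hχ, h2⟩ := h2
      have hχc : Continuous fun t => conj (χ t : ℂ) := by fun_prop
      have hint : ∀ v : G → ℂ, Continuous v → Integrable v μ := fun v hv =>
        hv.integrable_of_hasCompactSupport (HasCompactSupport.of_compactSpace _)
      -- the Fourier coefficients of a translate
      have h3 : ∫ t, u t * conj (χ t : ℂ) ∂μ =
          (χ (g - g') - 1) * ∫ t, F t y * conj (χ t : ℂ) ∂μ := by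
        have e1 : ∫ t, F (t + (g - g')) y * conj (χ t : ℂ) ∂μ =
            χ (g - g') * ∫ t, F t y * conj (χ t : ℂ) ∂μ := by
          rw [← integral_const_mul, ← integral_add_right_eq_self
            (fun t => (χ (g - g') : ℂ) * (F t y * conj (χ t : ℂ))) (g - g')]
          congr 1; ext t
          rw [AddChar.map_add_eq_mul, Circle.coe_mul, map_mul]
          have : (χ (g - g') : ℂ) * conj (χ (g - g') : ℂ) = 1 := by
            rw [← Circle.coe_inv_eq_conj, ← Circle.coe_mul, mul_inv_cancel, Circle.coe_one]
          linear_combination (-F (t + (g - g')) y * conj (χ t : ℂ)) * this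
        have e2 : ∀ t, u t * conj (χ t : ℂ) =
          F (t + (g - g')) y * conj (χ t : ℂ) - F t y * conj (χ t : ℂ) := fun t => sub_mul _ _ _
        simp only [e2]
        rw [integral_sub (hint (fun t => F (t + (g - g')) y * conj (χ t : ℂ)) (by fun_prop))
          (hint (fun t => F t y * conj (χ t : ℂ)) (by fun_prop)), e1]
        ring
      rw [h3] at h2
      obtain ⟨l, hl⟩ := exists_restrictsTo hj hχ
      have hlΓ := hΓ χ l hl ⟨y, right_ne_zero_of_mul h2⟩
      refine ⟨_, ⟨(⟨fun p => (χ p.1 : ℂ), by fun_prop⟩ : C(G × K, ℂ)), ⟨Unit, inferInstance,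
        fun _ => χ, fun _ => l, fun _ => 1, fun _ => hl, fun _ => hlΓ, ?_⟩, rfl⟩, ?_⟩
      · intro p; simp
      · intro h4
        apply left_ne_zero_of_mul h2
        have h5 : χ g = χ g' := Circle.ext h4
        rw [AddChar.map_sub_eq_div, h5, div_self', Circle.coe_one, sub_self]
  have hSW := ContinuousMap.starSubalgebra_topologicalClosure_eq_top_of_separatesPoints
    (charSums j Γ K) hsep
  let Φ : C(G × K, ℂ) := ⟨fun p => F p.1 p.2, by fun_prop⟩
  have hΦ : Φ ∈ (charSums j Γ K).topologicalClosure := by rw [hSW]; trivial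
  obtain ⟨P, hP, hPd⟩ := Metric.mem_closure_iff.1 hΦ ε hε
  obtain ⟨ι, _, χ, l, k, h1, h2, h3⟩ := hP
  refine ⟨ι, inferInstance, χ, l, k, h1, h2, fun g y => ?_⟩
  have h4 := (ContinuousMap.dist_apply_le_dist (f := Φ) (g := P) (g, y)).trans hPd.le
  rwa [dist_eq_norm, h3] at h4

end Approximation

/-! ### The approximation theorem -/

section ApproximationTheorem

open scoped ComplexConjugate

variable {n : ℕ} {K : Type} [MetricSpace K] [CompactSpace K]

/-- **Approximation theorem** for almost periodic functions, with a parameter `y ∈ K`: they are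
uniform limits of exponential sums with frequencies in the group generated by the spectrum. -/
theorem BohrAP.exists_approx {f : (Fin n → ℝ) → C(K, ℂ)} (hf : BohrAP f) (hc : Continuous f) :
    (∀ y, UAP fun x => f x y) ∧
    ∀ ε > 0, ∃ (ι : Type) (_ : Fintype ι) (l : ι → Fin n → ℝ) (k : ι → C(K, ℂ)),
      (∀ i, l i ∈ AddSubgroup.closure {l | ∃ y, coeff (fun x => f x y) l ≠ 0}) ∧
      ∀ x y, ‖f x y - ∑ i, k i y * ew (l i) x‖ ≤ ε := by
  obtain ⟨G, _, _, j, F, hj, hd, hFj, hF⟩ := hf.exists_compact_group hc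
  borelize G
  let μ : Measure G := Measure.addHaarMeasure ⊤
  have hμ : IsProbabilityMeasure μ := ⟨Measure.addHaarMeasure_self⟩
  have huap : ∀ y, UAP fun x => f x y := fun y ε hε => by
    obtain ⟨ι, _, χ, l, k, h1, -, h3⟩ := exists_charSum_near μ hj hF (Γ := ⊤)
      (fun _ _ _ _ => AddSubgroup.mem_top _) hε
    refine ⟨ι, inferInstance, l, fun i => k i y, fun x => ?_⟩
    have := h3 (j x) y
    simpa only [hFj, (h1 _).2] using this
  -- the Fourier coefficients on the compact group are the Fourier-Bohr coefficients
  have hcoeff : ∀ χ l y, RestrictsTo j χ l →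
      ∫ g, F g y * conj (χ g : ℂ) ∂μ = coeff (fun x => f x y) l := by
    intro χ l y hχ
    refine eq_of_forall_dist_le fun ε hε => ?_
    obtain ⟨ι, _, χ', l', k, h1, -, h3⟩ := exists_charSum_near μ hj hF (Γ := ⊤)
      (fun _ _ _ _ => AddSubgroup.mem_top _) (half_pos hε)
    have hint : ∀ v : G → ℂ, Continuous v → Integrable v μ := fun v hv =>
      hv.integrable_of_hasCompactSupport (HasCompactSupport.of_compactSpace _)
    have hFy : Continuous fun t => F t y := (continuous_eval_const y).comp F.continuous
    have hχc := hχ.1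
    have hχ'c := fun i => (h1 i).1
    set b := ∑ i, k i y * if l' i = l then (1 : ℂ) else 0 with hb
    have e1 : ‖coeff (fun x => f x y) l - b‖ ≤ ε / 2 := by
      rw [hb, ← coeff_trigPoly l' (fun i => k i y) l, ← (huap y).coeff_sub (uap_trigPoly _ _)]
      refine ((huap y).sub (uap_trigPoly _ _)).norm_coeff_le (fun x => ?_) l
      have := h3 (j x) y
      simpa only [hFj, (h1 _).2] using this
    have e2 : ∫ g, (∑ i, k i y * χ' i g) * conj (χ g : ℂ) ∂μ = b := by
      simp only [Finset.sum_mul]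
      rw [integral_finsetSum _ fun i _ => hint _ (by have := hχ'c i; fun_prop)]
      refine Finset.sum_congr rfl fun i _ => ?_
      have := ((h1 i).mul hχ.inv).integral μ hd
      simp only [← sub_eq_add_neg, sub_eq_zero] at this
      rw [← this, ← integral_const_mul]
      congr 1; ext g
      rw [AddChar.mul_apply, Circle.coe_mul, conj_eq_inv_apply, mul_assoc]
    have e3 : ‖∫ g, F g y * conj (χ g : ℂ) ∂μ - b‖ ≤ ε / 2 := by
      rw [← e2, ← integral_sub (hint _ (by fun_prop)) (hint _ (by fun_prop))]
      refine (norm_integral_le_of_norm_le_const (C := ε / 2)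
        (Eventually.of_forall fun g => ?_)).trans (by simp)
      rw [← sub_mul, norm_mul, RCLike.norm_conj, Circle.norm_coe, mul_one]
      exact h3 g y
    rw [dist_eq_norm]
    have := norm_sub_le (∫ g, F g y * conj (χ g : ℂ) ∂μ - b) (coeff (fun x => f x y) l - b)
    rw [sub_sub_sub_cancel_right] at this
    linarith
  refine ⟨huap, fun ε hε => ?_⟩
  obtain ⟨ι, _, χ, l, k, h1, h2, h3⟩ := exists_charSum_near μ hj hF
    (Γ := AddSubgroup.closure {l | ∃ y, coeff (fun x => f x y) l ≠ 0})
    (fun χ l hχ ⟨y, hy⟩ => AddSubgroup.subset_closure ⟨y, by rwa [← hcoeff χ l y hχ]⟩) hε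
  refine ⟨ι, inferInstance, l, k, h2, fun x y => ?_⟩
  have := h3 (j x) y
  simpa only [hFj, (h1 _).2] using this

end ApproximationTheorem

/-! ### The Fejér kernel -/

section FejerKernel

open scoped ComplexConjugate

lemma int_Icc_succ (N : ℕ) : Finset.Icc (-((N + 1 : ℕ) : ℤ)) ((N + 1 : ℕ) : ℤ) =
    insert ((N : ℤ) + 1) (insert (-((N : ℤ) + 1)) (Finset.Icc (-(N : ℤ)) N)) := by
  ext k; simp only [Finset.mem_Icc, Finset.mem_insert]; push_cast; omega

lemma sum_int_Icc_succ (N : ℕ) (a : ℤ → ℂ) :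
    ∑ k ∈ Finset.Icc (-((N + 1 : ℕ) : ℤ)) ((N + 1 : ℕ) : ℤ), a k =
      a (N + 1) + (a (-(N + 1)) + ∑ k ∈ Finset.Icc (-(N : ℤ)) N, a k) := by
  rw [int_Icc_succ, Finset.sum_insert, Finset.sum_insert]
  · simp
  · simp only [Finset.mem_Icc, Finset.mem_insert]; omega

/-- The Dirichlet kernel in terms of a one-sided geometric sum. -/
lemma dirichlet_sum (u : Circle) (N : ℕ) :
    ∑ k ∈ Finset.Icc (-(N : ℤ)) N, (u : ℂ) ^ k =
      1 + (u : ℂ) ^ N * conj (∑ a ∈ Finset.range N, (u : ℂ) ^ a) +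
        conj ((u : ℂ) ^ N) * ∑ a ∈ Finset.range N, (u : ℂ) ^ a := by
  have hu : (u : ℂ) * conj (u : ℂ) = 1 := by
    rw [← Circle.coe_inv_eq_conj, ← Circle.coe_mul, mul_inv_cancel, Circle.coe_one]
  have hinv : (u : ℂ)⁻¹ = conj (u : ℂ) := by
    rw [← Circle.coe_inv, Circle.coe_inv_eq_conj]
  induction N with
  | zero => simp
  | succ N ih =>
    rw [sum_int_Icc_succ, ih]
    have e1 : ∑ a ∈ Finset.range (N + 1), (u : ℂ) ^ a =
        u * ∑ a ∈ Finset.range N, (u : ℂ) ^ a + 1 := geom_sum_succ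
    have e2 : (u : ℂ) ^ (-((N : ℤ) + 1)) = conj (u : ℂ) ^ (N + 1) := by
      rw [← hinv, zpow_neg, ← inv_zpow]; norm_cast
    have e3 : (u : ℂ) ^ ((N : ℤ) + 1) = (u : ℂ) ^ (N + 1) := by norm_cast
    rw [e1, e2, e3]
    simp only [map_add, map_mul, map_pow, map_one]
    set D := ∑ a ∈ Finset.range N, (u : ℂ) ^ a
    linear_combination (-(u : ℂ) ^ N * conj D - conj (u : ℂ) ^ N * D) * hu

/-- The Fejér kernel is the square of the absolute value of a geometric sum. -/
lemma fejer_sum_nat (u : Circle) (N : ℕ) :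
    ∑ k ∈ Finset.Icc (-(N : ℤ)) N, ((N : ℂ) - (|(k : ℝ)| : ℝ)) * (u : ℂ) ^ k =
      (∑ a ∈ Finset.range N, (u : ℂ) ^ a) * conj (∑ a ∈ Finset.range N, (u : ℂ) ^ a) := by
  have hu : (u : ℂ) * conj (u : ℂ) = 1 := by
    rw [← Circle.coe_inv_eq_conj, ← Circle.coe_mul, mul_inv_cancel, Circle.coe_one]
  induction N with
  | zero => simp
  | succ N ih =>
    rw [sum_int_Icc_succ]
    have hp : |((N : ℝ) + 1)| = N + 1 := abs_of_pos (by positivity)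
    have e1 : (((N + 1 : ℕ) : ℂ) - (|((((N : ℤ) + 1 : ℤ)) : ℝ)| : ℝ)) = 0 := by
      push_cast; rw [hp]; push_cast; ring
    have e2 : (((N + 1 : ℕ) : ℂ) - (|(((-((N : ℤ) + 1) : ℤ)) : ℝ)| : ℝ)) = 0 := by
      push_cast; rw [abs_neg, hp]; push_cast; ring
    have e3 : ∑ k ∈ Finset.Icc (-(N : ℤ)) N,
        (((N + 1 : ℕ) : ℂ) - (|(k : ℝ)| : ℝ)) * (u : ℂ) ^ k =
        ∑ k ∈ Finset.Icc (-(N : ℤ)) N, ((N : ℂ) - (|(k : ℝ)| : ℝ)) * (u : ℂ) ^ k +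
        ∑ k ∈ Finset.Icc (-(N : ℤ)) N, (u : ℂ) ^ k := by
      rw [← Finset.sum_add_distrib]
      exact Finset.sum_congr rfl fun k _ => by push_cast; ring
    rw [e1, e2, e3, ih, dirichlet_sum, Finset.sum_range_succ]
    simp only [map_add, map_pow]
    have : (u : ℂ) ^ N * conj (u : ℂ) ^ N = 1 := by rw [← mul_pow, hu, one_pow]
    linear_combination -this

lemma exists_fejer_nonneg (u : Circle) {N : ℕ} (hN : N ≠ 0) : ∃ a : ℝ, 0 ≤ a ∧
    ∑ k ∈ Finset.Icc (-(N : ℤ)) N, ((1 - |(k : ℝ)| / N : ℝ) : ℂ) * (u : ℂ) ^ k = a := by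
  refine ⟨‖∑ a ∈ Finset.range N, (u : ℂ) ^ a‖ ^ 2 / N, by positivity, ?_⟩
  have hN' : (N : ℂ) ≠ 0 := by exact_mod_cast hN
  have h := fejer_sum_nat u N
  rw [Complex.mul_conj'] at h
  push_cast
  rw [← h, eq_div_iff hN', Finset.sum_mul]
  refine Finset.sum_congr rfl fun k _ => ?_
  field_simp

end FejerKernel

/-! ### Perturbed Bochner-Fejér sums -/

section BochnerFejer

variable {n : ℕ} {J : Type*} [Fintype J]

/-- The weight `∏ (1 - |ν_r| / N)` of the Bochner-Fejér kernel. -/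
noncomputable def fejerWeight (N : ℕ) (ν : J → ℤ) : ℝ := ∏ r, (1 - |(ν r : ℝ)| / N)

/-- The integer combination `∑ ν_r b_r`. -/
noncomputable def combo (b : J → Fin n → ℝ) (ν : J → ℤ) : Fin n → ℝ := ∑ r, (ν r : ℝ) • b r

/-- The box of multi-indices with `|ν_r| ≤ N`. -/
noncomputable def indexBox (J : Type*) [Fintype J] (N : ℕ) : Finset (J → ℤ) := by
  classical exact Fintype.piFinset fun _ : J => Finset.Icc (-(N : ℤ)) N

lemma mem_indexBox {N : ℕ} {ν : J → ℤ} : ν ∈ indexBox J N ↔ ∀ r, |ν r| ≤ N := by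
  simp [indexBox, abs_le]

/-- The Bochner-Fejér sum of the function `f` on `ℝⁿ` with basic frequencies `b`, perturbed by the
character `χ` of the frequency group. -/
noncomputable def fejerSum (N : ℕ) (b : J → Fin n → ℝ) (χ : AddChar (Fin n → ℝ) Circle)
    (f : (Fin n → ℝ) → ℂ) (x : Fin n → ℝ) : ℂ :=
  ∑ ν ∈ indexBox J N, (fejerWeight N ν : ℂ) * coeff f (combo b ν) * χ (combo b ν) *
    ew (combo b ν) x

/-- The character `l ↦ e^{i⟨x, l⟩}` of the frequency group. -/
noncomputable def freqChar (x : Fin n → ℝ) : AddChar (Fin n → ℝ) Circle where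
  toFun l := Circle.exp (x ⬝ᵥ l)
  map_zero_eq_one' := by simp
  map_add_eq_mul' l l' := by rw [dotProduct_add, Circle.exp_add]

lemma coe_freqChar (x l : Fin n → ℝ) : (freqChar x l : ℂ) = ew l x := by
  rw [ew, mul_comm]; exact Circle.coe_exp _

lemma addChar_combo (χ : AddChar (Fin n → ℝ) Circle) (b : J → Fin n → ℝ) (ν : J → ℤ) :
    (χ (combo b ν) : ℂ) = ∏ r, (χ (b r) : ℂ) ^ ν r := by
  rw [combo, addChar_map_sum, circle_coe_prod]
  refine Finset.prod_congr rfl fun r _ => ?_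
  rw [Int.cast_smul_eq_zsmul, AddChar.map_zsmul_eq_zpow, Circle.coe_zpow]

/-- The multi-dimensional kernel factors into Fejér kernels evaluated at `χ(b_r)`. -/
lemma exists_kernel_nonneg {N : ℕ} (hN : N ≠ 0) (b : J → Fin n → ℝ)
    (χ : AddChar (Fin n → ℝ) Circle) : ∃ a : ℝ, 0 ≤ a ∧
    ∑ ν ∈ indexBox J N, (fejerWeight N ν : ℂ) * χ (combo b ν) = a := by
  classical
  choose a ha h using fun r => exists_fejer_nonneg (χ (b r)) hN
  refine ⟨∏ r, a r, Finset.prod_nonneg fun r _ => ha r, ?_⟩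
  push_cast
  simp only [← h]
  rw [Finset.prod_univ_sum, indexBox]
  refine Finset.sum_congr (by congr!) fun ν _ => ?_
  rw [Finset.prod_mul_distrib, addChar_combo, fejerWeight, Complex.ofReal_prod]

variable {N : ℕ} {b : J → Fin n → ℝ} {χ : AddChar (Fin n → ℝ) Circle} {f g : (Fin n → ℝ) → ℂ}

/-- Bochner-Fejér sums, also the perturbed ones, do not increase the supremum norm: they are
averages against a kernel which is a product of translated Fejér kernels, hence nonnegative, and
whose mean is `1` since the basic frequencies are independent. -/
lemma norm_fejerSum_le (hN : N ≠ 0) (hb : ∀ ν : J → ℤ, combo b ν = 0 → ν = 0) (hf : UAP f)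
    {C : ℝ} (hC : ∀ x, ‖f x‖ ≤ C) (x : Fin n → ℝ) : ‖fejerSum N b χ f x‖ ≤ C := by
  let k : (Fin n → ℝ) → ℂ := fun t => ∑ ν ∈ indexBox J N,
    ((fejerWeight N ν : ℂ) * χ (combo b ν) * ew (combo b ν) x) * ew (-combo b ν) t
  have hkc : Continuous k := by fun_prop
  have hk : ∀ t, ∃ a : ℝ, 0 ≤ a ∧ k t = a := fun t => by
    obtain ⟨a, ha, h⟩ := exists_kernel_nonneg hN b (χ * freqChar (x - t))
    refine ⟨a, ha, h ▸ Finset.sum_congr rfl fun ν _ => ?_⟩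
    rw [AddChar.mul_apply, Circle.coe_mul, coe_freqChar, sub_eq_add_neg, ew_add]
    have : ew (combo b ν) (-t) = ew (-combo b ν) t := by simp [ew]
    rw [this]; ring
  choose a ha hka using hk
  have hac : Continuous a := by
    have : a = fun t => (k t).re := by ext t; rw [hka]; simp
    rw [this]; fun_prop
  have hmean : HasMean (fun t => (a t : ℂ)) 1 := by
    have h := HasMean.sum (indexBox J N)
      (f := fun ν t => ((fejerWeight N ν : ℂ) * χ (combo b ν) * ew (combo b ν) x) *
        ew (-combo b ν) t) (fun ν _ => by fun_prop)
      fun ν _ => (hasMean_ew (-combo b ν)).const_mul _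
    rw [Finset.sum_eq_single_of_mem (0 : J → ℤ) (mem_indexBox.2 fun r => by simp)
      fun ν _ hν => by rw [if_neg (by rw [neg_eq_zero]; exact fun h => hν (hb ν h)), mul_zero]] at h
    have h0 : combo b 0 = 0 := by simp [combo]
    have e : (fun t => (a t : ℂ)) = k := by ext t; rw [hka]
    rw [e]
    convert h using 1
    simp [h0, fejerWeight]
  have hprod : HasMean (fun t => k t * f t) (fejerSum N b χ f x) := by
    have h := HasMean.sum (indexBox J N)
      (f := fun ν t => ((fejerWeight N ν : ℂ) * χ (combo b ν) * ew (combo b ν) x) *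
        (ew (-combo b ν) t * f t)) (fun ν _ => by have := hf.continuous; fun_prop)
      fun ν _ => (hf.hasMean_coeff (combo b ν)).const_mul _
    convert h using 1
    · ext t
      rw [Finset.sum_mul]
      exact Finset.sum_congr rfl fun ν _ => by ring
    · exact Finset.sum_congr rfl fun ν _ => by ring
  have := HasMean.norm_le_of_weight ha hac hmean hprod (C := C) fun t => by
    rw [norm_mul, hka, Complex.norm_real, Real.norm_of_nonneg (ha t), mul_comm]
    exact mul_le_mul_of_nonneg_right (hC t) (ha t)
  simpa using this

lemma fejerSum_sub (hf : UAP f) (hg : UAP g) (x : Fin n → ℝ) :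
    fejerSum N b χ (fun t => f t - g t) x = fejerSum N b χ f x - fejerSum N b χ g x := by
  rw [fejerSum, fejerSum, fejerSum, ← Finset.sum_sub_distrib]
  exact Finset.sum_congr rfl fun ν _ => by rw [hf.coeff_sub hg]; ring

/-- The factor by which the Bochner-Fejér sum multiplies the exponential `e_l`. -/
noncomputable def fejerMultiplier (N : ℕ) (b : J → Fin n → ℝ) (l : Fin n → ℝ) : ℂ :=
  ∑ ν ∈ indexBox J N, (fejerWeight N ν : ℂ) * if l = combo b ν then 1 else 0

lemma fejerSum_trigPoly {ι : Type*} [Fintype ι] (l : ι → Fin n → ℝ) (c : ι → ℂ)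
    (x : Fin n → ℝ) :
    fejerSum N b χ (fun t => ∑ i, c i * ew (l i) t) x =
      ∑ i, c i * fejerMultiplier N b (l i) * χ (l i) * ew (l i) x := by
  simp only [fejerSum, coeff_trigPoly, fejerMultiplier, Finset.mul_sum, Finset.sum_mul]
  rw [Finset.sum_comm]
  refine Finset.sum_congr rfl fun i _ => Finset.sum_congr rfl fun ν _ => ?_
  by_cases h : l i = combo b ν
  · rw [if_pos h, h]; ring
  · simp [h]

lemma fejerMultiplier_combo (hb : ∀ ν : J → ℤ, combo b ν = 0 → ν = 0) {ν : J → ℤ}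
    (hν : ν ∈ indexBox J N) : fejerMultiplier N b (combo b ν) = fejerWeight N ν := by
  rw [fejerMultiplier, Finset.sum_eq_single_of_mem ν hν]
  · simp
  · intro ν' _ hne
    rw [if_neg, mul_zero]
    intro h
    apply hne
    rw [← sub_eq_zero]
    apply hb
    rw [← sub_eq_zero.2 h.symm]
    simp [combo, sub_smul]

/-- Bochner-Fejér sums of a family `f_y` which is uniformly approximable by exponential sums with
frequencies in `Λ` form a uniform Cauchy sequence, if the multipliers of the frequencies in `Λ`
converge. -/
theorem fejerSum_cauchy {Y : Type*} {J : ℕ → Type*} [∀ j, Fintype (J j)] {N : ℕ → ℕ}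
    {b : ∀ j, J j → Fin n → ℝ} (hN : ∀ j, N j ≠ 0)
    (hb : ∀ j, ∀ ν : J j → ℤ, combo (b j) ν = 0 → ν = 0) (χ : AddChar (Fin n → ℝ) Circle)
    {Λ : Set (Fin n → ℝ)}
    (hΛ : ∀ l ∈ Λ, Tendsto (fun j => fejerMultiplier (N j) (b j) l) atTop (𝓝 1))
    {f : Y → (Fin n → ℝ) → ℂ} (hf : ∀ y, UAP (f y))
    (happ : ∀ ε > 0, ∃ (ι : Type) (_ : Fintype ι) (l : ι → Fin n → ℝ) (k : ι → Y → ℂ),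
      (∀ i, l i ∈ Λ) ∧ (∀ i, ∃ B, ∀ y, ‖k i y‖ ≤ B) ∧
      ∀ y x, ‖f y x - ∑ i, k i y * ew (l i) x‖ ≤ ε) {ε : ℝ} (hε : 0 < ε) :
    ∃ M, ∀ i ≥ M, ∀ j ≥ M, ∀ y x,
      ‖fejerSum (N i) (b i) χ (f y) x - fejerSum (N j) (b j) χ (f y) x‖ ≤ ε := by
  obtain ⟨ι, _, l, k, hl, hk, h⟩ := happ (ε / 3) (by positivity)
  choose B hB using hk
  let P : Y → (Fin n → ℝ) → ℂ := fun y x => ∑ i, k i y * ew (l i) x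
  have hclose : ∀ j y x, ‖fejerSum (N j) (b j) χ (f y) x - fejerSum (N j) (b j) χ (P y) x‖ ≤
      ε / 3 := fun j y x => by
    rw [← fejerSum_sub (hf y) (uap_trigPoly _ _)]
    exact norm_fejerSum_le (hN j) (hb j) ((hf y).sub (uap_trigPoly _ _)) (h y) x
  let S : ℕ → ℝ := fun j => ∑ i, B i * ‖fejerMultiplier (N j) (b j) (l i) - 1‖
  have hS : Tendsto S atTop (𝓝 0) := by
    have : Tendsto S atTop (𝓝 (∑ i, B i * 0)) := by
      refine tendsto_finsetSum _ fun i _ => Tendsto.const_mul _ ?_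
      have := ((hΛ _ (hl i)).sub_const 1).norm
      simpa using this
    simpa using this
  let Q : Y → (Fin n → ℝ) → ℂ := fun y x => ∑ i, k i y * χ (l i) * ew (l i) x
  have hPQ : ∀ j y x, ‖fejerSum (N j) (b j) χ (P y) x - Q y x‖ ≤ S j := fun j y x => by
    simp only [P, Q, S]
    rw [fejerSum_trigPoly, ← Finset.sum_sub_distrib]
    refine norm_sum_le_of_le _ fun i _ => ?_
    have e : k i y * fejerMultiplier (N j) (b j) (l i) * χ (l i) * ew (l i) x -
        k i y * χ (l i) * ew (l i) x =
        k i y * (fejerMultiplier (N j) (b j) (l i) - 1) * χ (l i) * ew (l i) x := by ring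
    rw [e, norm_mul, norm_mul, norm_mul, norm_ew, Circle.norm_coe, mul_one, mul_one]
    exact mul_le_mul_of_nonneg_right (hB i y) (norm_nonneg _)
  obtain ⟨M, hM⟩ := eventually_atTop.1 (hS.eventually (gt_mem_nhds (show 0 < ε / 6 by positivity)))
  refine ⟨M, fun i hi j hj y x => ?_⟩
  have h1 := hclose i y x
  have h2 := hclose j y x
  have h3 := (hPQ i y x).trans (hM i hi).le
  have h4 := (hPQ j y x).trans (hM j hj).le
  have e : fejerSum (N i) (b i) χ (f y) x - fejerSum (N j) (b j) χ (f y) x =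
      (fejerSum (N i) (b i) χ (f y) x - fejerSum (N i) (b i) χ (P y) x) +
      (fejerSum (N i) (b i) χ (P y) x - Q y x) -
      (fejerSum (N j) (b j) χ (P y) x - Q y x) -
      (fejerSum (N j) (b j) χ (f y) x - fejerSum (N j) (b j) χ (P y) x) := by ring
  rw [e]
  refine (norm_sub_le _ _).trans ((add_le_add (norm_sub_le _ _) le_rfl).trans
    ((add_le_add (add_le_add (norm_add_le _ _) le_rfl) le_rfl).trans ?_))
  linarith

end BochnerFejer

/-! ### Convergence of the Bochner-Fejér multipliers -/

section Multipliers

variable {n : ℕ} {d : ℕ∞}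

/-- The inclusion of the first `j` indices. -/
def idxEmb (d : ℕ∞) (j : ℕ) : IdxTo d j ↪ Idx d where
  toFun r := ⟨(r.1 : ℕ), r.2⟩
  inj' _ _ h := Subtype.ext (Fin.ext (congrArg Subtype.val h))

/-- The frequencies `ω_r / j!` for the first `j` indices. -/
noncomputable def basicFreq (ω : Idx d → Fin n → ℝ) (j : ℕ) (r : IdxTo d j) : Fin n → ℝ :=
  (j ! : ℝ)⁻¹ • ω (idxEmb d j r)

lemma freq_eq_combo (ω : Idx d → Fin n → ℝ) (j : ℕ) (ν : IdxTo d j → ℤ) :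
    freq ω j ν = combo (basicFreq ω j) ν := rfl

lemma eq_zero_of_combo_basicFreq {ω : Idx d → Fin n → ℝ} (hω : LinearIndependent ℚ ω) (j : ℕ)
    (ν : IdxTo d j → ℤ) (h : combo (basicFreq ω j) ν = 0) : ν = 0 := by
  have h1 := Fintype.linearIndependent_iff.1 (hω.comp (idxEmb d j) (idxEmb d j).injective)
    (fun r => (ν r : ℚ) * (j ! : ℚ)⁻¹) (by
      rw [← h, combo]
      refine Finset.sum_congr rfl fun r _ => ?_
      rw [basicFreq, smul_smul, ← Rat.cast_smul_eq_qsmul ℝ]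
      push_cast
      rfl)
  ext r
  have h2 := h1 r
  have h3 : (j ! : ℚ)⁻¹ ≠ 0 := inv_ne_zero (by exact_mod_cast j.factorial_ne_zero)
  simpa [h3] using h2

/-- For a rational combination `l` of the `ω_r`, the Bochner-Fejér multipliers converge to `1`:
when `j!` is a common denominator, `l` is an integer combination of the `ω_r / j!`. -/
lemma tendsto_fejerMultiplier {ω : Idx d → Fin n → ℝ} (hω : LinearIndependent ℚ ω)
    {l : Fin n → ℝ} (hl : l ∈ Submodule.span ℚ (Set.range ω)) :
    Tendsto (fun j => fejerMultiplier (j ! ^ 2) (basicFreq ω j) l) atTop (𝓝 1) := by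
  obtain ⟨q, hq⟩ := Finsupp.mem_span_range_iff_exists_finsupp.1 hl
  have hlim : Tendsto (fun j : ℕ => ((∏ r ∈ q.support, (1 - |(q r : ℝ)| / (j ! : ℝ)) : ℝ) : ℂ))
      atTop (𝓝 1) := by
    have hf : Tendsto (fun j : ℕ => (j ! : ℝ)) atTop atTop :=
      tendsto_natCast_atTop_atTop.comp
        (tendsto_atTop_mono Nat.self_le_factorial tendsto_id)
    have : Tendsto (fun j : ℕ => ∏ r ∈ q.support, (1 - |(q r : ℝ)| / (j ! : ℝ))) atTop
        (𝓝 (∏ r ∈ q.support, (1 - 0))) :=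
      tendsto_finsetProd _ fun r _ => tendsto_const_nhds.sub (tendsto_const_nhds.div_atTop hf)
    have h2 := (Complex.continuous_ofReal.tendsto _).comp this
    simpa [Function.comp_def] using h2
  refine hlim.congr' ?_
  have hev : ∀ r ∈ q.support, ∀ᶠ j : ℕ in atTop,
      (r : ℕ) < j ∧ (q r).den ∣ j ! ∧ |q r| ≤ j ! := fun r _ => by
    obtain ⟨M, hM⟩ := exists_nat_ge |q r|
    filter_upwards [eventually_gt_atTop (r : ℕ), eventually_ge_atTop (q r).den,
      eventually_ge_atTop M] with j h1 h2 h3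
    refine ⟨h1, Nat.dvd_factorial (q r).den_pos h2, hM.trans ?_⟩
    exact_mod_cast h3.trans j.self_le_factorial
  filter_upwards [(Filter.eventually_all_finset _).2 hev] with j hj
  have hint : ∀ r : IdxTo d j, ∃ k : ℤ, (k : ℚ) = q (idxEmb d j r) * (j ! : ℚ) := fun r => by
    by_cases hr : idxEmb d j r ∈ q.support
    · obtain ⟨c, hc⟩ := (hj _ hr).2.1
      refine ⟨(q (idxEmb d j r)).num * c, ?_⟩
      rw [hc]; push_cast
      rw [← mul_assoc, Rat.mul_den_eq_num]
    · exact ⟨0, by rw [Finsupp.notMem_support_iff.1 hr]; simp⟩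
  choose ν hν using hint
  have hj0 : (j ! : ℝ) ≠ 0 := by exact_mod_cast j.factorial_ne_zero
  have hjpos : (0 : ℚ) < j ! := by exact_mod_cast j.factorial_pos
  have hνR : ∀ r, (ν r : ℝ) = (q (idxEmb d j r) : ℝ) * (j ! : ℝ) := fun r => by
    exact_mod_cast congrArg (Rat.cast : ℚ → ℝ) (hν r)
  have hsub : q.support ⊆ Finset.univ.map (idxEmb d j) := fun r hr => by
    rw [Finset.mem_map]
    exact ⟨⟨⟨r, (hj r hr).1⟩, r.2⟩, Finset.mem_univ _, rfl⟩
  have hcombo : combo (basicFreq ω j) ν = l := by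
    rw [← hq, Finsupp.sum, Finset.sum_subset hsub (fun r _ hr => by
      rw [Finsupp.notMem_support_iff.1 hr, zero_smul]), Finset.sum_map, combo]
    refine Finset.sum_congr rfl fun r _ => ?_
    rw [basicFreq, smul_smul, hνR, mul_assoc, mul_inv_cancel₀ hj0, mul_one,
      Rat.cast_smul_eq_qsmul]
  have hbox : ν ∈ indexBox (IdxTo d j) (j ! ^ 2) := by
    refine mem_indexBox.2 fun r => ?_
    have h1 : |q (idxEmb d j r)| ≤ j ! := by
      by_cases hr : idxEmb d j r ∈ q.support
      · exact (hj _ hr).2.2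
      · rw [Finsupp.notMem_support_iff.1 hr, abs_zero]; exact hjpos.le
    have h2 : |(ν r : ℚ)| ≤ (j ! : ℚ) ^ 2 := by
      rw [hν, abs_mul, abs_of_pos hjpos, sq]
      exact mul_le_mul_of_nonneg_right h1 hjpos.le
    exact_mod_cast h2
  rw [← hcombo, fejerMultiplier_combo (eq_zero_of_combo_basicFreq hω j) hbox]
  congr 1
  rw [fejerWeight, Finset.prod_subset hsub (fun r _ hr => by
      rw [Finsupp.notMem_support_iff.1 hr]; simp), Finset.prod_map]
  refine Finset.prod_congr rfl fun r _ => ?_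
  rw [hνR, abs_mul, abs_of_nonneg (Nat.cast_nonneg (j !) : (0 : ℝ) ≤ j !)]
  push_cast
  field_simp

end Multipliers

/-! ### Averages over segments -/

section SegmentAverage

variable {n : ℕ} {u : (Fin n → ℝ) → ℂ}

/-- The average of `u` over the segment from `x` to `x + Rv`. -/
noncomputable def segmentAverage (u : (Fin n → ℝ) → ℂ) (v : Fin n → ℝ) (R : ℝ) (x : Fin n → ℝ) :
    ℂ := (R : ℂ)⁻¹ * ∫ r in (0 : ℝ)..R, u (x + r • v)

lemma norm_segmentAverage_le {C R : ℝ} (hR : 0 < R) (hu : ∀ x, ‖u x‖ ≤ C) (v x : Fin n → ℝ) :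
    ‖segmentAverage u v R x‖ ≤ C := by
  have h := intervalIntegral.norm_integral_le_of_norm_le_const (a := 0) (b := R)
    (f := fun r : ℝ => u (x + r • v)) (fun r _ => hu _)
  rw [sub_zero, abs_of_pos hR] at h
  rw [segmentAverage, norm_mul, norm_inv, Complex.norm_real, Real.norm_of_nonneg hR.le,
    inv_mul_le_iff₀ hR]
  linarith

lemma segmentAverage_sub {w : (Fin n → ℝ) → ℂ} (hu : Continuous u) (hw : Continuous w)
    (v : Fin n → ℝ) (R : ℝ) (x : Fin n → ℝ) :
    segmentAverage (fun x => u x - w x) v R x =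
      segmentAverage u v R x - segmentAverage w v R x := by
  rw [segmentAverage, segmentAverage, segmentAverage, ← mul_sub, intervalIntegral.integral_sub]
  · exact Continuous.intervalIntegrable (by fun_prop) _ _
  · exact Continuous.intervalIntegrable (by fun_prop) _ _

lemma segmentAverage_trigPoly {ι : Type*} [Fintype ι] (l : ι → Fin n → ℝ) (c : ι → ℂ)
    (v : Fin n → ℝ) (R : ℝ) (x : Fin n → ℝ) :
    segmentAverage (fun x => ∑ i, c i * ew (l i) x) v R x =
      ∑ i, c i * segmentAverage (ew (l i)) v R 0 * ew (l i) x := by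
  simp only [segmentAverage]
  rw [intervalIntegral.integral_finsetSum fun i _ =>
    Continuous.intervalIntegrable (by fun_prop) _ _, Finset.mul_sum]
  refine Finset.sum_congr rfl fun i _ => ?_
  simp only [ew_add, zero_add, intervalIntegral.integral_const_mul]
  ring

/-- Averaging over segments preserves almost periodicity and the mean value. -/
lemma UAP.segmentAverage (hu : UAP u) (v : Fin n → ℝ) {R : ℝ} (hR : 0 < R) :
    UAP (segmentAverage u v R) ∧ mean (HolAP.segmentAverage u v R) = mean u := by
  have happ : ∀ ε > 0, ∃ (ι : Type) (_ : Fintype ι) (l : ι → Fin n → ℝ) (c : ι → ℂ),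
      (∀ x, ‖u x - ∑ i, c i * ew (l i) x‖ ≤ ε) ∧ ∀ x, ‖HolAP.segmentAverage u v R x -
        ∑ i, c i * HolAP.segmentAverage (ew (l i)) v R 0 * ew (l i) x‖ ≤ ε := by
    intro ε hε
    obtain ⟨ι, _, l, c, h⟩ := hu ε hε
    refine ⟨ι, inferInstance, l, c, h, fun x => ?_⟩
    rw [← segmentAverage_trigPoly, ← segmentAverage_sub hu.continuous (by fun_prop)]
    exact norm_segmentAverage_le hR h v x
  have huap : UAP (HolAP.segmentAverage u v R) := fun ε hε => by
    obtain ⟨ι, _, l, c, -, h⟩ := happ ε hε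
    exact ⟨ι, inferInstance, l, _, h⟩
  refine ⟨huap, eq_of_forall_dist_le fun ε hε => ?_⟩
  obtain ⟨ι, _, l, c, h1, h2⟩ := happ (ε / 2) (half_pos hε)
  have e1 := hu.sub (uap_trigPoly l c) |>.norm_mean_le h1
  rw [hu.mean_sub (uap_trigPoly l c), (hasMean_trigPoly l c).mean_eq] at e1
  have e2 := huap.sub (uap_trigPoly l _) |>.norm_mean_le h2
  rw [huap.mean_sub (uap_trigPoly l _), (hasMean_trigPoly l _).mean_eq] at e2
  have e3 : ∑ i, c i * HolAP.segmentAverage (ew (l i)) v R 0 * (if l i = 0 then (1 : ℂ) else 0) =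
      ∑ i, c i * if l i = 0 then (1 : ℂ) else 0 := by
    refine Finset.sum_congr rfl fun i _ => ?_
    split_ifs with h0
    · have hR' : (R : ℂ) ≠ 0 := by exact_mod_cast hR.ne'
      have : HolAP.segmentAverage (ew (l i)) v R 0 = 1 := by
        simp [HolAP.segmentAverage, h0, hR']
      rw [this, mul_one]
    · simp
  rw [e3] at e2
  rw [dist_eq_norm]
  have := norm_sub_le (mean (HolAP.segmentAverage u v R) -
    ∑ i, c i * if l i = 0 then (1 : ℂ) else 0) (mean u - ∑ i, c i * if l i = 0 then (1 : ℂ) else 0)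
  rw [sub_sub_sub_cancel_right] at this
  linarith

end SegmentAverage

/-! ### The Bohr transform on the tube -/

section Tube

variable {n m : ℕ} {Ω : Set (Fin n → ℝ)}

lemma im_cpoint (x y : Fin n → ℝ) : (fun k => (cpoint x y k).im) = y := by
  ext k; simp [cpoint]

lemma cpoint_mem_tube {x y : Fin n → ℝ} : cpoint x y ∈ tube Ω ↔ y ∈ Ω := by
  rw [tube, Set.mem_ofPred_eq, im_cpoint]

lemma eq_cpoint (z : Fin n → ℂ) : z = cpoint (fun k => (z k).re) fun k => (z k).im := by
  ext k; rw [cpoint, mul_comm, Complex.re_add_im]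

lemma cpoint_add (x t y : Fin n → ℝ) :
    cpoint (x + t) y = fun k => cpoint x y k + (t k : ℂ) := by
  ext k; simp only [cpoint, Pi.add_apply]; push_cast; ring

@[fun_prop]
lemma continuous_cpoint : Continuous fun p : (Fin n → ℝ) × (Fin n → ℝ) => cpoint p.1 p.2 := by
  unfold cpoint; fun_prop

lemma pairing_cpoint (x y l : Fin n → ℝ) :
    pairing (cpoint x y) l = ((x ⬝ᵥ l : ℝ) : ℂ) + Complex.I * ((y ⬝ᵥ l : ℝ) : ℂ) := by
  simp only [pairing, cpoint, dotProduct]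
  push_cast
  rw [Finset.mul_sum, ← Finset.sum_add_distrib]
  exact Finset.sum_congr rfl fun k _ => by ring

lemma exp_pairing_cpoint (x y l : Fin n → ℝ) :
    Complex.exp (Complex.I * pairing (cpoint x y) l) =
      Complex.exp (-((y ⬝ᵥ l : ℝ) : ℂ)) * ew l x := by
  rw [pairing_cpoint, ew, ← Complex.exp_add]
  congr 1
  linear_combination ((y ⬝ᵥ l : ℝ) : ℂ) * Complex.I_mul_I

lemma exp_neg_pairing_cpoint (x y l : Fin n → ℝ) :
    Complex.exp (-Complex.I * pairing (cpoint x y) l) =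
      Complex.exp ((y ⬝ᵥ l : ℝ) : ℂ) * ew (-l) x := by
  rw [neg_mul, Complex.exp_neg, exp_pairing_cpoint, mul_inv, ← Complex.exp_neg, neg_neg]
  congr 1
  rw [ew, ew, ← Complex.exp_neg, dotProduct_neg]
  push_cast; ring_nf

lemma bohrMean_eq (f : (Fin n → ℂ) → ℂ) (l y : Fin n → ℝ) (s : ℝ) :
    bohrMean f l y s = Complex.exp ((y ⬝ᵥ l : ℝ) : ℂ) *
      boxMean (fun x => ew (-l) x * f (cpoint x y)) s := by
  rw [← boxMean_const_mul, bohrMean, boxMean]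
  simp only [exp_neg_pairing_cpoint, mul_assoc]

lemma tendsto_bohrMean {f : (Fin n → ℂ) → ℂ} {y : Fin n → ℝ}
    (hf : UAP fun x => f (cpoint x y)) (l : Fin n → ℝ) :
    Tendsto (bohrMean f l y) atTop
      (𝓝 (Complex.exp ((y ⬝ᵥ l : ℝ) : ℂ) * coeff (fun x => f (cpoint x y)) l)) :=
  ((hf.hasMean_coeff l).const_mul _).congr fun s => by rw [boxMean_const_mul, bohrMean_eq]

lemma bohrTransform_eq (hne : Ω.Nonempty) {f : (Fin n → ℂ) → ℂ} {l : Fin n → ℝ} {c : ℂ}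
    (h : ∀ y ∈ Ω, Tendsto (bohrMean f l y) atTop (𝓝 c)) : bohrTransform Ω f l = c := by
  have hex : ∃ c : ℂ, ∀ y ∈ Ω, Tendsto (bohrMean f l y) atTop (𝓝 c) := ⟨c, h⟩
  rw [bohrTransform, dif_pos hex]
  obtain ⟨y, hy⟩ := hne
  exact tendsto_nhds_unique (hex.choose_spec y hy) (h y hy)

/-- The Bohr transform of a finite exponential sum. -/
lemma bohrTransform_expSum (hne : Ω.Nonempty) {ι : Type} [Fintype ι] (l : ι → Fin n → ℝ)
    (c : ι → ℂ) (l₀ : Fin n → ℝ) :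
    bohrTransform Ω (fun z => ∑ i, c i * Complex.exp (Complex.I * pairing z (l i))) l₀ =
      ∑ i, c i * if l i = l₀ then 1 else 0 := by
  refine bohrTransform_eq hne fun y _ => ?_
  have e : (fun x => ∑ i, c i * Complex.exp (Complex.I * pairing (cpoint x y) (l i))) =
      fun x => ∑ i, (c i * Complex.exp (-((y ⬝ᵥ l i : ℝ) : ℂ))) * ew (l i) x := by
    ext x; simp only [exp_pairing_cpoint, mul_assoc]
  have h := tendsto_bohrMean
    (f := fun z => ∑ i, c i * Complex.exp (Complex.I * pairing z (l i))) (y := y)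
    (e ▸ uap_trigPoly _ _) l₀
  convert h using 2
  rw [e, coeff_trigPoly, Finset.mul_sum]
  refine Finset.sum_congr rfl fun i _ => ?_
  split_ifs with hi
  · rw [hi, mul_one, mul_one, mul_left_comm, ← Complex.exp_add, add_neg_cancel, Complex.exp_zero,
      mul_one]
  · simp

/-- The perturbation of a finite exponential sum. -/
lemma perturb_expSum (hne : Ω.Nonempty) (χ : AddChar (Fin n → ℝ) Circle)
    {F : (Fin n → ℂ) → (Fin m → ℂ)} {ℓ : Fin m} {ι : Type} [Fintype ι] {l : ι → Fin n → ℝ}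
    {c : ι → ℂ} (hF : ∀ z, F z ℓ = ∑ i, c i * Complex.exp (Complex.I * pairing z (l i)))
    (z : Fin n → ℂ) :
    perturb Ω χ F z ℓ = ∑ i, c i * χ (l i) * Complex.exp (Complex.I * pairing z (l i)) := by
  classical
  simp only [perturb, spec, hF, bohrTransform_expSum hne]
  rw [finsum_mem_def, finsum_eq_sum_of_support_subset (s := Finset.univ.image l)]
  · have e : ∀ p : Fin n → ℝ, Set.indicator
        {p | ∑ i, c i * (if l i = p then (1 : ℂ) else 0) ≠ 0}
        (fun p => (∑ i, c i * if l i = p then (1 : ℂ) else 0) * (χ p : ℂ) *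
          Complex.exp (Complex.I * pairing z p)) p =
        (∑ i, c i * if l i = p then (1 : ℂ) else 0) * (χ p : ℂ) *
          Complex.exp (Complex.I * pairing z p) := fun p => by
      rw [Set.indicator_apply]
      split_ifs with hp
      · rfl
      · rw [Set.mem_ofPred_eq, not_not] at hp
        rw [hp, zero_mul, zero_mul]
    rw [Finset.sum_congr rfl fun p _ => e p]
    simp only [Finset.sum_mul]
    rw [Finset.sum_comm]
    refine Finset.sum_congr rfl fun i _ => ?_
    rw [Finset.sum_eq_single (l i)]
    · simp
    · intro p _ hp
      rw [if_neg hp.symm]; simp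
    · intro hi
      exact absurd (Finset.mem_image_of_mem l (Finset.mem_univ i)) hi
  · intro p hp
    rw [Finset.coe_image, Finset.coe_univ, Set.image_univ]
    by_contra hnp
    apply hp
    rw [Set.indicator_apply, if_neg]
    rw [Set.mem_ofPred_eq, not_not]
    refine Finset.sum_eq_zero fun i _ => ?_
    rw [if_neg fun h => hnp ⟨i, h⟩, mul_zero]

end Tube

/-! ### Slices of holomorphic almost periodic mappings -/

section Slices

variable {n m : ℕ} {Ω : Set (Fin n → ℝ)} {F : (Fin n → ℂ) → (Fin m → ℂ)}

lemma IsHAP.continuous_slice (hF : IsHAP Ω F) {K : Set (Fin n → ℝ)} (hK : K ⊆ Ω) (ℓ : Fin m) :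
    Continuous fun p : (Fin n → ℝ) × K => F (cpoint p.1 p.2) ℓ := by
  have h1 : ContinuousOn (fun z => F z ℓ) (tube Ω) :=
    (continuous_apply ℓ).comp_continuousOn hF.1.continuousOn
  exact h1.comp_continuous (continuous_cpoint.comp (by fun_prop :
    Continuous fun p : (Fin n → ℝ) × K => (p.1, (p.2 : Fin n → ℝ))))
    fun p => cpoint_mem_tube.2 (hK p.2.2)

/-- The component `f_ℓ` over a compact subset `K` of the base, as a function on `ℝⁿ` with values in
`C(K)`. -/
noncomputable def IsHAP.slice (hF : IsHAP Ω F) {K : Set (Fin n → ℝ)} (hK : K ⊆ Ω) (ℓ : Fin m) :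
    C(Fin n → ℝ, C(K, ℂ)) :=
  ContinuousMap.curry ⟨_, hF.continuous_slice hK ℓ⟩

lemma IsHAP.slice_apply (hF : IsHAP Ω F) {K : Set (Fin n → ℝ)} (hK : K ⊆ Ω) (ℓ : Fin m)
    (x : Fin n → ℝ) (y : K) : hF.slice hK ℓ x y = F (cpoint x y) ℓ := rfl

lemma relCompactIn_of_isCompact {K : Set (Fin n → ℝ)} (hK : IsCompact K) (hKΩ : K ⊆ Ω) :
    RelCompactIn K Ω := by
  rw [RelCompactIn, hK.isClosed.closure_eq]; exact ⟨hK, hKΩ⟩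

lemma IsHAP.bohrAP_slice (hF : IsHAP Ω F) {K : Set (Fin n → ℝ)} (hKc : IsCompact K) (hK : K ⊆ Ω)
    (ℓ : Fin m) [CompactSpace K] : BohrAP (hF.slice hK ℓ) := by
  intro ε hε
  obtain ⟨t, ht, h⟩ := hF.2 ε hε K (relCompactIn_of_isCompact hKc hK)
  refine ⟨‖t‖, fun ξ => ?_⟩
  obtain ⟨τ, hτ, hτ'⟩ := h ξ
  refine ⟨τ, (pi_norm_le_iff_of_nonneg (norm_nonneg _)).2 fun k => ?_, fun x => ?_⟩
  · refine (hτ k).le.trans ((le_abs_self _).trans ?_)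
    exact norm_le_pi_norm t k
  · refine (ContinuousMap.norm_le _ hε.le).2 fun y => ?_
    rw [ContinuousMap.sub_apply, hF.slice_apply, hF.slice_apply, cpoint_add]
    exact (hτ' _ (cpoint_mem_tube.2 y.2) ℓ).le

lemma IsHAP.uap (hF : IsHAP Ω F) {y : Fin n → ℝ} (hy : y ∈ Ω) (ℓ : Fin m) :
    UAP fun x => F (cpoint x y) ℓ := by
  have hK : ({y} : Set (Fin n → ℝ)) ⊆ Ω := by simpa using hy
  exact ((hF.bohrAP_slice isCompact_singleton hK ℓ).exists_approx
    (hF.slice hK ℓ).continuous).1 ⟨y, rfl⟩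

lemma IsHAP.exists_bound (hF : IsHAP Ω F) {K : Set (Fin n → ℝ)} (hKc : IsCompact K) (hK : K ⊆ Ω)
    (ℓ : Fin m) : ∃ B, ∀ x, ∀ y ∈ K, ‖F (cpoint x y) ℓ‖ ≤ B := by
  have : CompactSpace K := isCompact_iff_compactSpace.1 hKc
  obtain ⟨B, hB⟩ := (hF.bohrAP_slice hKc hK ℓ).bounded (hF.slice hK ℓ).continuous
  exact ⟨B, fun x y hy => ((hF.slice hK ℓ x).norm_coe_le_norm ⟨y, hy⟩).trans (hB x)⟩

/-- The limits defining the Bohr transform do not depend on `y`: by Cauchy's theorem on the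
rectangle with vertices `0`, `R`, `R + i`, `i` in the direction `y' - y`, averages over segments of
parameter length `R` above `y` and `y'` differ by `O(1/R)`. -/
lemma IsHAP.coeff_indep (hF : IsHAP Ω F) (hconv : Convex ℝ Ω) (ℓ : Fin m)
    (l : Fin n → ℝ) {y y' : Fin n → ℝ} (hy : y ∈ Ω) (hy' : y' ∈ Ω) :
    Complex.exp ((y ⬝ᵥ l : ℝ) : ℂ) * coeff (fun x => F (cpoint x y) ℓ) l =
      Complex.exp ((y' ⬝ᵥ l : ℝ) : ℂ) * coeff (fun x => F (cpoint x y') ℓ) l := by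
  let h : (Fin n → ℂ) → ℂ := fun z => Complex.exp (-Complex.I * pairing z l) * F z ℓ
  have hd : DifferentiableOn ℂ h (tube Ω) := by
    have h1 : DifferentiableOn ℂ (fun z => F z ℓ) (tube Ω) := differentiableOn_pi.1 hF.1 ℓ
    have h2 : Differentiable ℂ fun z : Fin n → ℂ => Complex.exp (-Complex.I * pairing z l) := by
      unfold pairing; fun_prop
    exact h2.differentiableOn.mul h1
  have hslice : ∀ y x, h (cpoint x y) =
      Complex.exp ((y ⬝ᵥ l : ℝ) : ℂ) * (ew (-l) x * F (cpoint x y) ℓ) := fun y x => by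
    simp only [h, exp_neg_pairing_cpoint, mul_assoc]
  have huap : ∀ y ∈ Ω, UAP fun x => h (cpoint x y) := fun y hy => by
    simp only [hslice]
    exact ((hF.uap hy ℓ).ew_mul (-l)).const_mul _
  have hmean : ∀ y ∈ Ω, mean (fun x => h (cpoint x y)) =
      Complex.exp ((y ⬝ᵥ l : ℝ) : ℂ) * coeff (fun x => F (cpoint x y) ℓ) l := fun y hy => by
    simp only [hslice]
    exact (((hF.uap hy ℓ).hasMean_coeff l).const_mul _).mean_eq
  let v := y' - y
  let K := (fun s : ℝ => y + s • v) '' Set.Icc 0 1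
  have hKc : IsCompact K := isCompact_Icc.image (by fun_prop)
  have hK : K ⊆ Ω := by
    rintro _ ⟨s, hs, rfl⟩
    exact hconv.add_smul_sub_mem hy hy' hs
  obtain ⟨B, hB⟩ : ∃ B, ∀ x, ∀ y ∈ K, ‖h (cpoint x y)‖ ≤ B := by
    obtain ⟨B, hB⟩ := hF.exists_bound hKc hK ℓ
    obtain ⟨D, hD⟩ := hKc.exists_bound_of_continuousOn
      (f := fun y => Complex.exp ((y ⬝ᵥ l : ℝ) : ℂ)) (by fun_prop)
    refine ⟨D * B, fun x y hy => ?_⟩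
    rw [hslice, norm_mul, norm_mul, norm_ew, one_mul]
    exact mul_le_mul (hD y hy) (hB x y hy) (norm_nonneg _) ((norm_nonneg _).trans (hD y hy))
  have hB0 : 0 ≤ B := (norm_nonneg _).trans (hB 0 y ⟨0, by simp, by simp⟩)
  have hpt : ∀ (x : Fin n → ℝ) (r s : ℝ), (fun k => cpoint x y k + ((r : ℂ) + s * Complex.I) * v k)
      = cpoint (x + r • v) (y + s • v) := fun x r s => by
    ext k; simp only [cpoint, Pi.add_apply, Pi.smul_apply, smul_eq_mul]; push_cast; ring
  have hrect : ∀ (x : Fin n → ℝ) (R : ℝ), 0 < R →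
      ‖(∫ r in (0 : ℝ)..R, h (cpoint (x + r • v) y)) -
        ∫ r in (0 : ℝ)..R, h (cpoint (x + r • v) y')‖ ≤ 2 * B := by
    intro x R hR
    let g : ℂ → ℂ := fun w => h fun k => cpoint x y k + w * v k
    have hg : ∀ r s : ℝ, g (r + s * Complex.I) = h (cpoint (x + r • v) (y + s • v)) := fun r s =>
      congrArg h (hpt x r s)
    have hgd : DifferentiableOn ℂ g (Set.uIcc (0 : ℂ).re ((R : ℂ) + Complex.I).re ×ℂ
        Set.uIcc (0 : ℂ).im ((R : ℂ) + Complex.I).im) := by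
      refine hd.comp (Differentiable.differentiableOn (by fun_prop)) fun w hw => ?_
      rw [Complex.mem_reProdIm] at hw
      have h1 : w.im ∈ Set.Icc (0 : ℝ) 1 := by simpa using hw.2
      rw [← Complex.re_add_im w, hpt]
      exact cpoint_mem_tube.2 (hK ⟨w.im, h1, rfl⟩)
    have hC := Complex.integral_boundary_rect_eq_zero_of_differentiableOn g 0
      ((R : ℂ) + Complex.I) hgd
    have hside : ∀ r : ℝ, ‖∫ s in (0 : ℝ)..1, g (r + s * Complex.I)‖ ≤ B := fun r => by
      have := intervalIntegral.norm_integral_le_of_norm_le_const (a := 0) (b := 1) (C := B)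
        (f := fun s : ℝ => g (r + s * Complex.I)) fun s hs => by
          rw [hg]
          rw [Set.uIoc_of_le zero_le_one] at hs
          exact hB _ _ ⟨s, ⟨hs.1.le, hs.2⟩, rfl⟩
      simpa using this
    have e0 : ∀ r : ℝ, g (r + ((0 : ℝ) : ℂ) * Complex.I) = h (cpoint (x + r • v) y) := fun r => by
      rw [hg]; simp
    have e1 : ∀ r : ℝ, g (r + ((1 : ℝ) : ℂ) * Complex.I) = h (cpoint (x + r • v) y') := fun r => by
      rw [hg]; simp [v]
    simp only [Complex.zero_re, Complex.zero_im, Complex.add_re, Complex.add_im, Complex.ofReal_re,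
      Complex.ofReal_im, Complex.I_re, Complex.I_im, add_zero, zero_add] at hC
    simp only [e0, e1] at hC
    have e2 : (∫ r in (0 : ℝ)..R, h (cpoint (x + r • v) y)) -
        (∫ r in (0 : ℝ)..R, h (cpoint (x + r • v) y')) =
        Complex.I • (∫ s in (0 : ℝ)..1, g ((0 : ℝ) + s * Complex.I)) -
        Complex.I • (∫ s in (0 : ℝ)..1, g (R + s * Complex.I)) := by
      linear_combination hC
    rw [e2]
    refine (norm_sub_le _ _).trans ?_
    rw [norm_smul, norm_smul, Complex.norm_I, one_mul, one_mul, two_mul]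
    exact add_le_add (hside _) (hside _)
  rw [← hmean y hy, ← hmean y' hy']
  refine eq_of_forall_dist_le fun ε hε => ?_
  let R := 2 * B / ε + 1
  have hR : 0 < R := by positivity
  have h1 := (huap y hy).segmentAverage v hR
  have h2 := (huap y' hy').segmentAverage v hR
  rw [← h1.2, ← h2.2, dist_eq_norm, ← h1.1.mean_sub h2.1]
  refine (h1.1.sub h2.1).norm_mean_le fun x => ?_
  rw [segmentAverage, segmentAverage, ← mul_sub, norm_mul, norm_inv, Complex.norm_real,
    Real.norm_of_nonneg hR.le, inv_mul_le_iff₀ hR]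
  refine (hrect x R hR).trans ?_
  simp only [R]
  rw [add_mul, div_mul_cancel₀ _ hε.ne']
  linarith

/-- The Bohr transform in terms of the Fourier-Bohr coefficients of a single slice. -/
lemma IsHAP.bohrTransform_eq (hF : IsHAP Ω F) (hconv : Convex ℝ Ω) (ℓ : Fin m)
    (l : Fin n → ℝ) {y : Fin n → ℝ} (hy : y ∈ Ω) :
    bohrTransform Ω (fun z => F z ℓ) l =
      Complex.exp ((y ⬝ᵥ l : ℝ) : ℂ) * coeff (fun x => F (cpoint x y) ℓ) l :=
  HolAP.bohrTransform_eq ⟨y, hy⟩ fun y' hy' => by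
    rw [hF.coeff_indep hconv ℓ l hy hy']
    exact tendsto_bohrMean (f := fun z => F z ℓ) (hF.uap hy' ℓ) l

end Slices

/-! ### Almost periodicity of exponential sums -/

section ExponentialSums

variable {n m : ℕ} {Ω : Set (Fin n → ℝ)}

/-- Finitely many frequencies have relatively dense common almost periods, because the curve
`x ↦ (e_{l_i}(x))_i` has totally bounded range. -/
lemma exists_common_almostPeriod {ι : Type*} [Fintype ι] (l : ι → Fin n → ℝ) {δ : ℝ}
    (hδ : 0 < δ) : ∃ M : ℝ, 0 < M ∧ ∀ ξ : Fin n → ℝ, ∃ τ : Fin n → ℝ, (∀ k, |τ k - ξ k| < M) ∧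
      ∀ i, ‖ew (l i) τ - 1‖ < δ := by
  let Φ : (Fin n → ℝ) → (ι → ℂ) := fun x i => ew (l i) x
  have htb : TotallyBounded (Set.range Φ) := by
    refine (isCompact_closedBall (0 : ι → ℂ) 1).totallyBounded.subset ?_
    rintro _ ⟨x, rfl⟩
    rw [mem_closedBall_zero_iff]
    exact (pi_norm_le_iff_of_nonneg zero_le_one).2 fun i => (norm_ew _ _).le
  obtain ⟨T, hT, hTf, hTc⟩ := Metric.finite_approx_of_totallyBounded htb δ hδ
  choose p hp using fun y : T => hT y.2
  have := hTf.to_subtype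
  obtain ⟨M, hM⟩ := (Set.finite_range fun y : T => ‖p y‖).bddAbove
  refine ⟨|M| + 1, by positivity, fun ξ => ?_⟩
  have h1 := hTc ⟨ξ, rfl⟩
  simp only [Set.mem_iUnion, Metric.mem_ball] at h1
  obtain ⟨y, hy, h2⟩ := h1
  refine ⟨ξ - p ⟨y, hy⟩, fun k => ?_, fun i => ?_⟩
  · have h3 := norm_le_pi_norm (p ⟨y, hy⟩) k
    have h4 : ‖p ⟨y, hy⟩‖ ≤ M := hM ⟨⟨y, hy⟩, rfl⟩
    rw [Pi.sub_apply, sub_sub_cancel_left, abs_neg, ← Real.norm_eq_abs]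
    linarith [le_abs_self M]
  · rw [dist_eq_norm] at h2
    have h3 := (norm_le_pi_norm (Φ ξ - y) i).trans_lt h2
    have e : Φ ξ - y = Φ ξ - Φ (p ⟨y, hy⟩) := by rw [hp]
    rw [e] at h3
    have e2 : ew (l i) ξ = ew (l i) (ξ - p ⟨y, hy⟩) * ew (l i) (p ⟨y, hy⟩) := by
      rw [← ew_add, sub_add_cancel]
    have e3 : (Φ ξ - Φ (p ⟨y, hy⟩)) i =
        (ew (l i) (ξ - p ⟨y, hy⟩) - 1) * ew (l i) (p ⟨y, hy⟩) := by
      simp only [Φ, Pi.sub_apply]; rw [e2]; ring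
    rwa [e3, norm_mul, norm_ew, mul_one] at h3

/-- Exponential sums are holomorphic almost periodic mappings. -/
lemma isHAP_expSum {ι : Type*} [Fintype ι] (l : ι → Fin n → ℝ) (c : Fin m → ι → ℂ)
    {F : (Fin n → ℂ) → (Fin m → ℂ)}
    (hF : ∀ z ∈ tube Ω, ∀ ℓ, F z ℓ = ∑ i, c ℓ i * Complex.exp (Complex.I * pairing z (l i))) :
    IsHAP Ω F := by
  constructor
  · have h : Differentiable ℂ fun (z : Fin n → ℂ) ℓ =>
        ∑ i, c ℓ i * Complex.exp (Complex.I * pairing z (l i)) := by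
      unfold pairing; fun_prop
    exact h.differentiableOn.congr fun z hz => funext fun ℓ => hF z hz ℓ
  · intro ε hε Ω' hΩ'
    have hD : ∀ i, ∃ D, ∀ y ∈ Ω', ‖Complex.exp (-((y ⬝ᵥ l i : ℝ) : ℂ))‖ ≤ D := fun i => by
      obtain ⟨D, hD⟩ := hΩ'.1.exists_bound_of_continuousOn
        (f := fun y => Complex.exp (-((y ⬝ᵥ l i : ℝ) : ℂ))) (by fun_prop)
      exact ⟨D, fun y hy => hD y (subset_closure hy)⟩
    choose D hD using hD
    let A : ℝ := ∑ ℓ, ∑ i, ‖c ℓ i‖ * |D i|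
    have hA : 0 ≤ A := by positivity
    obtain ⟨M, hM, h⟩ := exists_common_almostPeriod l (show 0 < ε / (A + 1) by positivity)
    refine ⟨fun _ => M, fun _ => hM, fun ξ => ?_⟩
    obtain ⟨τ, hτ, hτ'⟩ := h ξ
    refine ⟨τ, hτ, fun z hz ℓ => ?_⟩
    rw [eq_cpoint z] at hz ⊢
    set x : Fin n → ℝ := fun k => (z k).re
    set y : Fin n → ℝ := fun k => (z k).im
    have hy : y ∈ Ω' := cpoint_mem_tube.1 hz
    have hyΩ : y ∈ Ω := hΩ'.2 (subset_closure hy)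
    rw [← cpoint_add, hF _ (cpoint_mem_tube.2 hyΩ), hF _ (cpoint_mem_tube.2 hyΩ),
      ← Finset.sum_sub_distrib]
    have hterm : ∀ i, ‖c ℓ i * Complex.exp (Complex.I * pairing (cpoint (x + τ) y) (l i)) -
        c ℓ i * Complex.exp (Complex.I * pairing (cpoint x y) (l i))‖ ≤
        ‖c ℓ i‖ * |D i| * (ε / (A + 1)) := fun i => by
      rw [exp_pairing_cpoint, exp_pairing_cpoint, ew_add]
      have e : c ℓ i * (Complex.exp (-((y ⬝ᵥ l i : ℝ) : ℂ)) * (ew (l i) x * ew (l i) τ)) -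
          c ℓ i * (Complex.exp (-((y ⬝ᵥ l i : ℝ) : ℂ)) * ew (l i) x) =
          c ℓ i * Complex.exp (-((y ⬝ᵥ l i : ℝ) : ℂ)) * ew (l i) x * (ew (l i) τ - 1) := by ring
      rw [e, norm_mul, norm_mul, norm_mul, norm_ew, mul_one]
      have := (hD i y hy).trans (le_abs_self _)
      exact mul_le_mul (mul_le_mul_of_nonneg_left this (norm_nonneg _)) (hτ' i).le
        (norm_nonneg _) (by positivity)
    refine (norm_sum_le_of_le _ fun i _ => hterm i).trans_lt ?_
    rw [← Finset.sum_mul]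
    have h1 : ∑ i, ‖c ℓ i‖ * |D i| ≤ A :=
      Finset.single_le_sum (f := fun ℓ => ∑ i, ‖c ℓ i‖ * |D i|)
        (fun _ _ => by positivity) (Finset.mem_univ ℓ)
    calc _ ≤ A * (ε / (A + 1)) := by gcongr
      _ < ε := by
        rw [← mul_div_assoc, div_lt_iff₀ (by positivity)]
        nlinarith

end ExponentialSums

/-! ### Limits in the space of holomorphic almost periodic mappings -/

section Limits

/-- **Weierstrass theorem** in several variables: the limit of a sequence of holomorphic mappings
which converges uniformly near `z₀` is complex differentiable at `z₀`. -/
lemma differentiableAt_of_tendstoUniformlyOn_ball {E E' : Type*} [NormedAddCommGroup E]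
    [NormedSpace ℂ E] [NormedAddCommGroup E'] [NormedSpace ℂ E'] [CompleteSpace E']
    {G : ℕ → E → E'} {H : E → E'} {z₀ : E} {r : ℝ} (hr : 0 < r)
    (hG : ∀ j, DifferentiableOn ℂ (G j) (Metric.ball z₀ (2 * r)))
    (hlim : TendstoUniformlyOn G H atTop (Metric.ball z₀ (2 * r))) : DifferentiableAt ℂ H z₀ := by
  have hsub : Metric.ball z₀ r ⊆ Metric.ball z₀ (2 * r) := Metric.ball_subset_ball (by linarith)
  have hd : ∀ j, ∀ z ∈ Metric.ball z₀ r, DifferentiableAt ℂ (G j) z := fun j z hz =>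
    (hG j).differentiableAt (Metric.isOpen_ball.mem_nhds (hsub hz))
  -- the derivatives form a uniform Cauchy sequence by the Schwarz lemma
  have hC : UniformCauchySeqOn (fun j => fderiv ℂ (G j)) atTop (Metric.ball z₀ r) := by
    rw [Metric.uniformCauchySeqOn_iff]
    intro ε hε
    obtain ⟨M, hM⟩ := Metric.uniformCauchySeqOn_iff.1 hlim.uniformCauchySeqOn (ε * r / 4)
      (by positivity)
    refine ⟨M, fun i hi j hj z hz => ?_⟩
    rw [dist_eq_norm, ← fderiv_sub (hd i z hz) (hd j z hz)]
    have hb : Metric.ball z r ⊆ Metric.ball z₀ (2 * r) := by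
      refine Metric.ball_subset_ball' ?_
      rw [Metric.mem_ball] at hz
      linarith
    have hmaps : Set.MapsTo (G i - G j) (Metric.ball z r)
        (Metric.closedBall ((G i - G j) z) (ε * r / 2)) := fun w hw => by
      have h1 := hM i hi j hj w (hb hw)
      have h2 := hM i hi j hj z (hsub hz)
      rw [dist_eq_norm] at h1 h2
      rw [Metric.mem_closedBall, dist_eq_norm]
      refine (norm_sub_le _ _).trans ?_
      simp only [Pi.sub_apply]
      linarith
    have := Complex.norm_fderiv_le_div_of_mapsTo_ball (((hG i).sub (hG j)).mono hb) hmaps hr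
    refine this.trans_lt ?_
    rw [div_lt_iff₀ hr]
    nlinarith
  have hex : ∀ z ∈ Metric.ball z₀ r, ∃ L, Tendsto (fun j => fderiv ℂ (G j) z) atTop (𝓝 L) :=
    fun z hz => cauchy_iff_exists_le_nhds.1 (hC.cauchy_map hz)
  have hT := hC.tendstoUniformlyOn_of_tendsto
    (f := fun z => limUnder atTop fun j => fderiv ℂ (G j) z) fun z hz => by
      exact tendsto_nhds_limUnder (hex z hz)
  exact (hasFDerivAt_of_tendstoUniformlyOn Metric.isOpen_ball hT
    (fun j z hz => (hd j z hz).hasFDerivAt) (fun z hz => hlim.tendsto_at (hsub hz))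
    (Metric.mem_ball_self hr)).differentiableAt

variable {n m : ℕ} {Ω : Set (Fin n → ℝ)} {G : ℕ → (Fin n → ℂ) → (Fin m → ℂ)}
  {H : (Fin n → ℂ) → (Fin m → ℂ)}

lemma relCompactIn_singleton {y : Fin n → ℝ} (hy : y ∈ Ω) : RelCompactIn {y} Ω :=
  relCompactIn_of_isCompact isCompact_singleton (by simpa using hy)

lemma TendstoTau.tendsto_at (h : TendstoTau Ω G H) {z : Fin n → ℂ} (hz : z ∈ tube Ω) :
    Tendsto (fun j => G j z) atTop (𝓝 (H z)) :=
  (h _ (relCompactIn_singleton hz)).tendsto_at (Set.mem_singleton _)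

/-- The space of holomorphic almost periodic mappings is closed under limits in `τ(T_Ω)`. -/
lemma IsHAP.of_tendstoTau (hΩ : IsOpen Ω) (hG : ∀ j, IsHAP Ω (G j)) (h : TendstoTau Ω G H) :
    IsHAP Ω H := by
  constructor
  · intro z hz
    obtain ⟨r, hr, hrΩ⟩ := Metric.nhds_basis_closedBall.mem_iff.1 (hΩ.mem_nhds hz)
    have hsub : Metric.ball z (2 * (r / 2)) ⊆
        tube (Metric.closedBall (fun k => (z k).im) r) := fun w hw => by
      rw [mul_div_cancel₀ _ two_ne_zero, Metric.mem_ball, dist_pi_lt_iff hr] at hw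
      change _ ∈ Metric.closedBall _ _
      rw [Metric.mem_closedBall, dist_pi_le_iff hr.le]
      intro k
      rw [Real.dist_eq, ← Complex.sub_im]
      refine (Complex.abs_im_le_norm _).trans ?_
      rw [← dist_eq_norm]
      exact (hw k).le
    exact (differentiableAt_of_tendstoUniformlyOn_ball (half_pos hr)
      (fun j => (hG j).1.mono (hsub.trans fun w hw => hrΩ hw))
      ((h _ (relCompactIn_of_isCompact (isCompact_closedBall _ _) hrΩ)).mono
        hsub)).differentiableWithinAt
  · intro ε hε Ω' hΩ'
    obtain ⟨j, hj⟩ := (Metric.tendstoUniformlyOn_iff.1 (h Ω' hΩ') (ε / 4)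
      (by positivity)).exists
    obtain ⟨t, ht, hτ⟩ := (hG j).2 (ε / 4) (by positivity) Ω' hΩ'
    refine ⟨t, ht, fun ξ => ?_⟩
    obtain ⟨τ, h1, h2⟩ := hτ ξ
    refine ⟨τ, h1, fun z hz ℓ => ?_⟩
    have hzτ : (fun k => z k + (τ k : ℂ)) ∈ tube Ω' := by
      rw [tube, Set.mem_ofPred_eq]; simpa [tube] using hz
    have h3 := hj _ hzτ
    have h4 := hj _ hz
    rw [dist_eq_norm] at h3 h4
    have h5 := (norm_le_pi_norm _ ℓ).trans_lt h3
    have h6 := (norm_le_pi_norm _ ℓ).trans_lt h4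
    simp only [Pi.sub_apply] at h5 h6
    have h7 := h2 z hz ℓ
    have e : H (fun k => z k + (τ k : ℂ)) ℓ - H z ℓ =
        (H (fun k => z k + (τ k : ℂ)) ℓ - G j (fun k => z k + (τ k : ℂ)) ℓ) +
        (G j (fun k => z k + (τ k : ℂ)) ℓ - G j z ℓ) - (H z ℓ - G j z ℓ) := by ring
    rw [e]
    refine (norm_sub_le _ _).trans_lt ?_
    have := norm_add_le (H (fun k => z k + (τ k : ℂ)) ℓ - G j (fun k => z k + (τ k : ℂ)) ℓ)
      (G j (fun k => z k + (τ k : ℂ)) ℓ - G j z ℓ)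
    linarith

/-- Cauchy sequences for `τ(T_Ω)` converge. -/
lemma CauchyTau.exists_tendstoTau (h : CauchyTau Ω G) : ∃ H, TendstoTau Ω G H := by
  have hex : ∀ z ∈ tube Ω, ∃ L, Tendsto (fun j => G j z) atTop (𝓝 L) := fun z hz =>
    cauchy_iff_exists_le_nhds.1
      ((h _ (relCompactIn_singleton hz)).cauchy_map (x := z) (Set.mem_singleton _))
  refine ⟨fun z => limUnder atTop fun j => G j z, fun Ω' hΩ' => ?_⟩
  refine (h Ω' hΩ').tendstoUniformlyOn_of_tendsto fun z hz => ?_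
  exact tendsto_nhds_limUnder (hex z (hΩ'.2 (subset_closure hz)))

end Limits

/-! ### The perturbed Bochner-Fejér approximations -/

section Main

variable {n m : ℕ} {Ω : Set (Fin n → ℝ)} {F : (Fin n → ℂ) → (Fin m → ℂ)} {d : ℕ∞}

/-- The Bochner-Fejér approximation as an exponential sum. -/
lemma bochnerFejer_apply (ω : Idx d → Fin n → ℝ) (j : ℕ) (z : Fin n → ℂ) (ℓ : Fin m) :
    bochnerFejer Ω F ω j z ℓ = ∑ ν : indexBox (IdxTo d j) (j ! ^ 2),
      ((fejerWeight (j ! ^ 2) ν.1 : ℂ) *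
        bohrTransform Ω (fun w => F w ℓ) (combo (basicFreq ω j) ν.1)) *
      Complex.exp (Complex.I * pairing z (combo (basicFreq ω j) ν.1)) := by
  rw [Finset.sum_coe_sort (indexBox (IdxTo d j) (j ! ^ 2)) fun ν =>
    ((fejerWeight (j ! ^ 2) ν : ℂ) *
        bohrTransform Ω (fun w => F w ℓ) (combo (basicFreq ω j) ν)) *
      Complex.exp (Complex.I * pairing z (combo (basicFreq ω j) ν)), bochnerFejer]
  refine Finset.sum_congr ?_ fun ν _ => ?_
  · ext ν; simp [mem_indexBox, abs_le]
  · rw [freq_eq_combo, fejerWeight]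
    push_cast
    rfl

lemma isExp_bochnerFejer (ω : Idx d → Fin n → ℝ) (j : ℕ) : IsExp Ω (bochnerFejer Ω F ω j) := by
  classical
  intro ℓ
  refine ⟨Finset.univ.image fun ν : indexBox (IdxTo d j) (j ! ^ 2) => combo (basicFreq ω j) ν.1,
    fun l => ∑ ν : indexBox (IdxTo d j) (j ! ^ 2), if combo (basicFreq ω j) ν.1 = l then
      (fejerWeight (j ! ^ 2) ν.1 : ℂ) *
        bohrTransform Ω (fun w => F w ℓ) (combo (basicFreq ω j) ν.1) else 0, fun z _ => ?_⟩
  rw [bochnerFejer_apply]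
  simp only [Finset.sum_mul]
  rw [Finset.sum_comm]
  refine Finset.sum_congr rfl fun ν _ => ?_
  rw [Finset.sum_eq_single (combo (basicFreq ω j) ν.1)]
  · simp
  · intro l _ hl
    rw [if_neg hl.symm, zero_mul]
  · intro hν
    exact absurd (Finset.mem_image_of_mem _ (Finset.mem_univ ν)) hν

lemma perturb_bochnerFejer (hne : Ω.Nonempty) (χ : AddChar (Fin n → ℝ) Circle)
    (ω : Idx d → Fin n → ℝ) (j : ℕ) (z : Fin n → ℂ) (ℓ : Fin m) :
    perturb Ω χ (bochnerFejer Ω F ω j) z ℓ = ∑ ν : indexBox (IdxTo d j) (j ! ^ 2),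
      ((fejerWeight (j ! ^ 2) ν.1 : ℂ) *
        bohrTransform Ω (fun w => F w ℓ) (combo (basicFreq ω j) ν.1)) *
      χ (combo (basicFreq ω j) ν.1) *
      Complex.exp (Complex.I * pairing z (combo (basicFreq ω j) ν.1)) :=
  perturb_expSum hne χ (fun z => bochnerFejer_apply ω j z ℓ) z

/-- On each slice of the tube, the perturbed Bochner-Fejér approximation is a perturbed
Bochner-Fejér sum on `ℝⁿ`. -/
lemma perturb_bochnerFejer_cpoint (hF : IsHAP Ω F) (hconv : Convex ℝ Ω)
    (χ : AddChar (Fin n → ℝ) Circle) (ω : Idx d → Fin n → ℝ) (j : ℕ) {y : Fin n → ℝ} (hy : y ∈ Ω)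
    (x : Fin n → ℝ) (ℓ : Fin m) :
    perturb Ω χ (bochnerFejer Ω F ω j) (cpoint x y) ℓ =
      fejerSum (j ! ^ 2) (basicFreq ω j) χ (fun x => F (cpoint x y) ℓ) x := by
  rw [perturb_bochnerFejer ⟨y, hy⟩, fejerSum]
  refine Eq.trans ?_ (Finset.sum_coe_sort (indexBox (IdxTo d j) (j ! ^ 2)) _)
  refine Finset.sum_congr rfl fun ν _ => ?_
  set l := combo (basicFreq ω j) ν.1
  rw [hF.bohrTransform_eq hconv ℓ l hy, exp_pairing_cpoint]
  have : Complex.exp ((y ⬝ᵥ l : ℝ) : ℂ) * Complex.exp (-((y ⬝ᵥ l : ℝ) : ℂ)) = 1 := by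
    rw [← Complex.exp_add, add_neg_cancel, Complex.exp_zero]
  linear_combination ((fejerWeight (j ! ^ 2) ν.1 : ℂ) * coeff (fun x => F (cpoint x y) ℓ) l *
    χ l * ew l x) * this

lemma isHAP_perturb_bochnerFejer (hne : Ω.Nonempty) (χ : AddChar (Fin n → ℝ) Circle)
    (ω : Idx d → Fin n → ℝ) (j : ℕ) : IsHAP Ω (perturb Ω χ (bochnerFejer Ω F ω j)) :=
  isHAP_expSum _ _ fun z _ ℓ => perturb_bochnerFejer hne χ ω j z ℓ

/-- The perturbed Bochner-Fejér approximations form a Cauchy sequence. -/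
lemma cauchyTau_perturb_bochnerFejer (hF : IsHAP Ω F) (hconv : Convex ℝ Ω)
    (χ : AddChar (Fin n → ℝ) Circle) {ω : Idx d → Fin n → ℝ} (hω : LinearIndependent ℚ ω)
    (hspan : linQ Ω F ≤ Submodule.span ℚ (Set.range ω)) :
    CauchyTau Ω fun j => perturb Ω χ (bochnerFejer Ω F ω j) := by
  intro Ω' hΩ'
  rw [Metric.uniformCauchySeqOn_iff]
  intro ε hε
  have : CompactSpace (closure Ω') := isCompact_iff_compactSpace.1 hΩ'.1
  have key : ∀ ℓ : Fin m, ∃ M, ∀ i ≥ M, ∀ j ≥ M, ∀ (y : closure Ω') (x : Fin n → ℝ),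
      ‖fejerSum (i ! ^ 2) (basicFreq ω i) χ (fun x => F (cpoint x y) ℓ) x -
        fejerSum (j ! ^ 2) (basicFreq ω j) χ (fun x => F (cpoint x y) ℓ) x‖ ≤ ε / 2 := by
    intro ℓ
    refine fejerSum_cauchy (Λ := Submodule.span ℚ (Set.range ω))
      (f := fun (y : closure Ω') x => F (cpoint x y) ℓ)
      (fun j => pow_ne_zero 2 j.factorial_ne_zero) (eq_zero_of_combo_basicFreq hω) χ
      (fun l hl => tendsto_fejerMultiplier hω hl) (fun y => hF.uap (hΩ'.2 y.2) ℓ) ?_ (half_pos hε)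
    intro η hη
    obtain ⟨ι, _, l, k, hl, h⟩ := ((hF.bohrAP_slice hΩ'.1 hΩ'.2 ℓ).exists_approx
      (hF.slice hΩ'.2 ℓ).continuous).2 η hη
    refine ⟨ι, inferInstance, l, fun i y => k i y, fun i => hspan (Submodule.subset_span ?_),
      fun i => ⟨_, (k i).norm_coe_le_norm⟩, fun y x => h x y⟩
    refine AddSubgroup.closure_mono ?_ (hl i)
    rintro p ⟨y, hy⟩
    refine Set.mem_iUnion.2 ⟨ℓ, ?_⟩
    rw [spec, Set.mem_ofPred_eq, hF.bohrTransform_eq hconv ℓ p (hΩ'.2 y.2)]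
    exact mul_ne_zero (Complex.exp_ne_zero _) hy
  choose M hM using key
  refine ⟨Finset.univ.sup M, fun i hi j hj z hz => ?_⟩
  rw [dist_eq_norm]
  refine lt_of_le_of_lt ((pi_norm_le_iff_of_nonneg (half_pos hε).le).2 fun ℓ => ?_)
    (half_lt_self hε)
  have hMℓ : M ℓ ≤ Finset.univ.sup M := Finset.le_sup (Finset.mem_univ ℓ)
  have hy : (fun k => (z k).im) ∈ closure Ω' := subset_closure hz
  rw [Pi.sub_apply, eq_cpoint z, perturb_bochnerFejer_cpoint hF hconv χ ω i (hΩ'.2 hy),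
    perturb_bochnerFejer_cpoint hF hconv χ ω j (hΩ'.2 hy)]
  exact hM ℓ i (hMℓ.trans hi) j (hMℓ.trans hj) ⟨_, hy⟩ _

end Main

end HolAP

theorem theorem3p1 {n m : ℕ} (Ω : Set (Fin n → ℝ)) (hne : Ω.Nonempty) (hopen : IsOpen Ω)
    (hconv : Convex ℝ Ω) (F : (Fin n → ℂ) → (Fin m → ℂ)) (hF : HolAP.IsHAP Ω F)
    (χ : AddChar (Fin n → ℝ) Circle)
    (d : ℕ∞) (ω : Module.Basis (HolAP.Idx d) ℚ (HolAP.linQ Ω F))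
    (Q : ℕ → (Fin n → ℂ) → (Fin m → ℂ))
    (hQ : Q = HolAP.bochnerFejer Ω F (fun r => (ω r : Fin n → ℝ))) :
    (∀ j, HolAP.IsExp Ω (Q j)) ∧
    (∀ j, HolAP.IsHAP Ω (HolAP.perturb Ω χ (Q j))) ∧
    HolAP.CauchyTau Ω (fun j => HolAP.perturb Ω χ (Q j)) ∧
    ∃ Fχ : (Fin n → ℂ) → (Fin m → ℂ),
      HolAP.IsHAP Ω Fχ ∧ HolAP.TendstoTau Ω (fun j => HolAP.perturb Ω χ (Q j)) Fχ ∧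
      ∀ G : (Fin n → ℂ) → (Fin m → ℂ), HolAP.IsHAP Ω G →
        HolAP.TendstoTau Ω (fun j => HolAP.perturb Ω χ (Q j)) G →
        Set.EqOn G Fχ (HolAP.tube Ω) := by
  subst hQ
  have hω : LinearIndependent ℚ fun r => (ω r : Fin n → ℝ) :=
    ω.linearIndependent.map' (HolAP.linQ Ω F).subtype (Submodule.ker_subtype _)
  have hspan : HolAP.linQ Ω F ≤ Submodule.span ℚ (Set.range fun r => (ω r : Fin n → ℝ)) := by
    intro l hl
    have h1 : (⟨l, hl⟩ : HolAP.linQ Ω F) ∈ Submodule.span ℚ (Set.range ω) := by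
      rw [ω.span_eq]; trivial
    have h2 := Submodule.mem_map_of_mem (f := (HolAP.linQ Ω F).subtype) h1
    rw [Submodule.map_span, ← Set.range_comp] at h2
    exact h2
  have hC := HolAP.cauchyTau_perturb_bochnerFejer hF hconv χ hω hspan
  have hHAP := fun j => HolAP.isHAP_perturb_bochnerFejer (Ω := Ω) (F := F) hne χ
    (fun r => (ω r : Fin n → ℝ)) j
  obtain ⟨H, hH⟩ := hC.exists_tendstoTau
  exact ⟨HolAP.isExp_bochnerFejer _, hHAP, hC, H, HolAP.IsHAP.of_tendstoTau hopen hHAP hH, hH,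
    fun G _ hG z hz => tendsto_nhds_unique (hG.tendsto_at hz) (hH.tendsto_at hz)⟩
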